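/- **Setting.** Fix a signature of constructors and destructors, each with an arity and a status (public or private); each destructor $g$ has a finite set $\mathrm{def}(g)$ of rewrite rules $g(M_1,\dots,M_n)\to M$ on terms without names, with the variables of $M$ among those of $M_1,\dots,M_n$. Processes are those of the pi calculus with output, input, nil, parallel composition, replication, restriction, destructor application, conditional and $\mathtt{event}(M)$, where channels are arbitrary terms. For a finite set $\mathrm{Init}$ of names, an $\mathrm{Init}$-*adversary* is a closed process $Q$ with $\mathrm{fn}(Q)\subseteq\mathrm{Init}$ that contains no events and uses only public constructors and destructors. *Instrumentation.* Patterns are built from variables, constructors, and names $a[p_1,\dots,p_n,i_1,\dots,i_{n'}]$, where the $i_k$ are session identifiers (constants or variables of a separate sort, respected by substitutions). The instrumented process $P'_0=\mathrm{instr}(P_0)$ labels each replication with a session identifier and each restriction $(\nu a)$ with $a[t,s]$, where $t$ lists the variables bound above it by inputs and by non-deterministic destructor applications, and $s$ the session identifiers of the replications above it. The instrumentation $\mathrm{instrAdv}(Q)$ of an adversary labels restrictions with $b_0[a[s]]$ instead. Instrumented configurations are triples $S,E,\mathcal P$, where $S$ is the set of unused session identifiers and $E$ maps names to closed patterns; (Red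 Repl) takes a constant $\lambda\in S$, removes it from $S$ and substitutes it for the session identifier, (Red Res) creates a name $a'\notin\mathrm{dom}(E)$ and maps it to $E(\ell)$, where $\ell$ is the label, and the other rules are the usual ones. A trace satisfies the atom $\mathrm{message}(N,M)$ if it contains a communication of $M$ on channel $N$, $\mathrm{attacker}(M)$ if it contains a communication of $M$ on a channel $c\in\mathrm{Init}$, and $\mathrm{event}(M)$ if it contains an execution of $\mathtt{event}(M)$; it satisfies a fact $F$ if it satisfies some atom $\alpha$ with $E'(\alpha)=F$, where $E'$ is its last environment. Facts are $\mathrm{attacker}(p)$, $\mathrm{message}(p,p')$, $\mathrm{event}(p)$ and $\mathrm{m\text{-}event}(p)$; no trace satisfies a fact $\mathrm{m\text{-}event}(p)$. *Correspondences.* $P'_0$ satisfies the correspondence $F\Rightarrow\bigvee_{j=1}^m\bigl(F_j\rightsquigarrow\bigwedge_{k=1}^{l_j}\mathrm{event}(p_{jk})\bigr)$ against $\mathrm{Init}$-adversaries if, for every $\mathrm{Init}$-adversary $Q$, every trace $\mathcal T$ from $S_0,E_0,\{P'_0,\mathrm{instrAdv}(Q)\}$ with $\mathrm{fn}(P'_0)\cup\mathrm{Init}\subseteq\mathrm{dom}(E_0)$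 and $E_0(a)=a[\,]$ for all $a\in\mathrm{dom}(E_0)$, and every substitution $\sigma$ such that $\mathcal T$ satisfies $\sigma F$, there are a substitution $\sigma'$ and $j\in\{1,\dots,m\}$ such that $\sigma'F_j=\sigma F$ and $\mathcal T$ satisfies $\mathrm{event}(\sigma'p_{jk})$ for all $k\in\{1,\dots,l_j\}$. *Clauses.* Let $\mathcal R_{P'_0,\mathrm{Init}}$ be the Horn clauses $[\![P'_0]\!]\rho\emptyset$ of the process, with $\rho(a)=a[\,]$ for free names, together with the attacker clauses: $\mathrm{attacker}(a[\,])$ for $a\in\mathrm{Init}$; $\mathrm{attacker}(b_0[x])$; $\bigwedge_i\mathrm{attacker}(x_i)\Rightarrow\mathrm{attacker}(f(x_1,\dots,x_n))$ for public constructors $f$; $\bigwedge_i\mathrm{attacker}(M_i)\Rightarrow\mathrm{attacker}(M)$ for each rule $g(M_1,\dots,M_n)\to M$ of a public destructor; $\mathrm{message}(x,y)\wedge\mathrm{attacker}(x)\Rightarrow\mathrm{attacker}(y)$; and $\mathrm{attacker}(x)\wedge\mathrm{attacker}(y)\Rightarrow\mathrm{message}(x,y)$. In $[\![P]\!]\rho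 H$, an input on $M$ adds $\mathrm{message}(\rho(M),x)$ ($x$ fresh) to the hypotheses $H$; an output of $N$ on $M$ adds the clause $H\Rightarrow\mathrm{message}(\rho(M),\rho(N))$; $\mathtt{event}(M)$ adds the clause $H\Rightarrow\mathrm{event}(\rho(M))$ and then the hypothesis $\mathrm{m\text{-}event}(\rho(M))$; a restriction maps its name to the pattern of its label; destructor applications and conditionals apply most general unifiers in the success branch and nothing in the else branch. *Solving.* Let $\mathsf{sel}$ map each clause $H\Rightarrow C$ to a set of hypotheses in $H$, never containing a fact $\mathrm{attacker}(x)$ with $x$ a variable nor a fact $\mathrm{m\text{-}event}(p)$ (the unselectable facts), and with $\mathsf{sel}(H\Rightarrow\mathrm{attacker}(x))\ne\emptyset$ whenever $H$ contains a selectable fact. Let $\mathcal F_{\mathrm{not}}$ be any set of facts. Clauses are simplified by decomposing data constructors, removing duplicate hypotheses, (optionally) redundant hypotheses, clauses with a hypothesis that is an instance of a fact of $\mathcal F_{\mathrm{not}}$, tautologies, and hypotheses $\mathrm{attacker}(x)$ with $x$ not occurring elsewhere. $\mathsf{saturate}$ inserts the simplified clauses, then closes the set under resolution of a clause $R$ with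 $\mathsf{sel}(R)=\emptyset$ on a selected hypothesis of another clause, simplifying and removing subsumed clauses, until a fixpoint is reached, and returns the clauses with no selected hypothesis. $\mathsf{derivable}(F,\mathcal R_1)$ is the backward search by resolution with $\mathcal R_1$ on selected hypotheses, started from $F\Rightarrow F$ (simplifying without decomposing the conclusion and without removing tautologies, and cutting clauses subsumed by an earlier clause of the branch), which returns the clauses reached that have no selected hypothesis. Finally, with $\mathcal R_1=\mathsf{saturate}(\mathcal R_{P'_0,\mathrm{Init}})$, $\mathsf{solve}_{P'_0,\mathrm{Init}}(F)$ fails with an error if $\mathsf{derivable}(F',\mathcal R_1)\ne\emptyset$ for some $F'\in\mathcal F_{\mathrm{not}}$, and otherwise returns $\mathsf{derivable}(F,\mathcal R_1)$. **Theorem.** Let $P_0$ be a closed process and $P'_0=\mathrm{instr}(P_0)$. Let $p_{jk}$ ($1\le j\le m$, $1\le k\le l_j$) be patterns and let $F$ and $F_j$ ($1\le j\le m$) be facts. Suppose that $\mathsf{solve}_{P'_0,\mathrm{Init}}(F)$ terminates without error and that for every clause $R$ in $\mathsf{solve}_{P'_0,\mathrm{Init}}(F)$ there are $j\in\{1,\dots,m\}$,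 a substitution $\sigma'$ and a conjunction $H$ of facts such that $$R \;=\; H\wedge\mathrm{m\text{-}event}(\sigma'p_{j1})\wedge\dots\wedge\mathrm{m\text{-}event}(\sigma'p_{jl_j})\Rightarrow\sigma'F_j,$$ where repeated hypotheses are identified. Then $P'_0$ satisfies the correspondence $F\Rightarrow\bigvee_{j=1}^m\bigl(F_j\rightsquigarrow\bigwedge_{k=1}^{l_j}\mathrm{event}(p_{jk})\bigr)$ against $\mathrm{Init}$-adversaries. -/

import Mathlib

universe u v

namespace PV

/-! ### Cryptographic primitives -/

/-- Terms without names, as used in rewrite rules; variables are numbered. -/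
inductive RTerm (Con : Type u) (ar : Con → ℕ) : Type u
  | var (x : ℕ) : RTerm Con ar
  | app (f : Con) (ts : Fin (ar f) → RTerm Con ar) : RTerm Con ar

def RTerm.vars {Con : Type u} {ar : Con → ℕ} : RTerm Con ar → Set ℕ
  | .var x => {x}
  | .app _ ts => ⋃ i, (ts i).vars

/-- A rewrite rule `g(M₁, …, Mₙ) → M` (the symbol `g` is left implicit): the terms contain no
names, and the variables of `M` occur in `M₁, …, Mₙ`. -/
structure Rule (Con : Type u) (ar : Con → ℕ) (n : ℕ) : Type u where
  lhs : Fin n → RTerm Con ar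
  rhs : RTerm Con ar
  rhs_vars : rhs.vars ⊆ ⋃ i, (lhs i).vars

/-- Constructors and destructors with their arities, the public/private status of each symbol,
and the finite set of rewrite rules `def(g)` of each destructor. -/
structure Signature : Type (max (u + 1) (v + 1)) where
  Con : Type u
  Des : Type v
  conArity : Con → ℕ
  desArity : Des → ℕ
  conPublic : Con → Prop
  desPublic : Des → Prop
  rules : (g : Des) → Finset (Rule Con conArity (desArity g))

abbrev Signature.RTm (Sg : Signature.{u, v}) : Type u := RTerm Sg.Con Sg.conArity

/-- A data constructor: a (public) constructor `f` of arity `n` that comes with (public)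
destructors `gᵢ`, for `i = 1, …, n`, defined by the single rule `gᵢ(f(x₁, …, xₙ)) → xᵢ`. -/
def Signature.IsData (Sg : Signature.{u, v}) (f : Sg.Con) : Prop :=
  Sg.conPublic f ∧ ∀ i : Fin (Sg.conArity f), ∃ g : Sg.Des, Sg.desPublic g ∧ Sg.desArity g = 1 ∧
    ∃ x : Fin (Sg.conArity f) → ℕ, Function.Injective x ∧ ∃ r, Sg.rules g = {r} ∧
      (∀ j, r.lhs j = .app f (fun k => .var (x k))) ∧ r.rhs = .var (x i)

/-! ### Terms and processes

Processes are identified up to renaming of bound identifiers, so bound variables and bound names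
are represented by de Bruijn indices: `Term Sg n` and `Proc Sg n` have `n` bound identifiers in
scope, index `0` being the innermost one, and a closed process is an element of `Proc Sg 0`.
A restriction keeps the name `a` that it binds in the source text, because this name is used as a
name function symbol by the instrumentation. -/

/-- Names. -/
abbrev Name : Type := ℕ

inductive Term (Sg : Signature.{u, v}) (n : ℕ) : Type u
  | bvar (i : Fin n) : Term Sg n
  | name (a : Name) : Term Sg n
  | app (f : Sg.Con) (ts : Fin (Sg.conArity f) → Term Sg n) : Term Sg n

inductive Proc (Sg : Signature.{u, v}) : ℕ → Type (max u v)
  | out {n : ℕ} (M N : Term Sg n) (P : Proc Sg n) : Proc Sg n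
  | inp {n : ℕ} (M : Term Sg n) (P : Proc Sg (n + 1)) : Proc Sg n
  | nil {n : ℕ} : Proc Sg n
  | par {n : ℕ} (P Q : Proc Sg n) : Proc Sg n
  | repl {n : ℕ} (P : Proc Sg n) : Proc Sg n
  | res {n : ℕ} (a : Name) (P : Proc Sg (n + 1)) : Proc Sg n
  | letd {n : ℕ} (g : Sg.Des) (Ms : Fin (Sg.desArity g) → Term Sg n)
      (P : Proc Sg (n + 1)) (Q : Proc Sg n) : Proc Sg n
  | cond {n : ℕ} (M N : Term Sg n) (P Q : Proc Sg n) : Proc Sg n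
  | event {n : ℕ} (M : Term Sg n) (P : Proc Sg n) : Proc Sg n

section
variable {Sg : Signature.{u, v}}

def Term.names {n : ℕ} : Term Sg n → Set Name
  | .bvar _ => ∅
  | .name a => {a}
  | .app _ ts => ⋃ i, (ts i).names

def Term.PublicOnly {n : ℕ} : Term Sg n → Prop
  | .bvar _ => True
  | .name _ => True
  | .app f ts => Sg.conPublic f ∧ ∀ i, (ts i).PublicOnly

def Term.subst {n m : ℕ} (s : Fin n → Term Sg m) : Term Sg n → Term Sg m
  | .bvar i => s i
  | .name a => .name a
  | .app f ts => .app f (fun i => (ts i).subst s)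

/-- The substitution `s` under one more binder. -/
def Term.lift {n m : ℕ} (s : Fin n → Term Sg m) : Fin (n + 1) → Term Sg (m + 1) :=
  Fin.cases (.bvar 0) (fun i => (s i).subst (fun j => .bvar j.succ))

def RTerm.toTerm {n : ℕ} (s : ℕ → Term Sg n) : Sg.RTm → Term Sg n
  | .var x => s x
  | .app f ts => .app f (fun i => (ts i).toTerm s)

/-- `g(M₁, …, Mₙ) → M`: the arguments and the result are an instance of a rule of `def(g)`. -/
def Reduces {n : ℕ} (g : Sg.Des) (Ms : Fin (Sg.desArity g) → Term Sg n) (M : Term Sg n) : Prop :=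
  ∃ r ∈ Sg.rules g, ∃ s : ℕ → Term Sg n, (∀ i, Ms i = (r.lhs i).toTerm s) ∧ M = r.rhs.toTerm s

/-- The destructor may return several different results for the same arguments. -/
def NonDet (g : Sg.Des) : Prop :=
  ∃ (Ms : Fin (Sg.desArity g) → Term Sg 0) (M M' : Term Sg 0),
    Reduces g Ms M ∧ Reduces g Ms M' ∧ M ≠ M'

/-- Free names. -/
def Proc.fn {n : ℕ} : Proc Sg n → Set Name
  | .out M N P => M.names ∪ N.names ∪ P.fn
  | .inp M P => M.names ∪ P.fn
  | .nil => ∅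
  | .par P Q => P.fn ∪ Q.fn
  | .repl P => P.fn
  | .res _ P => P.fn
  | .letd _ Ms P Q => (⋃ i, (Ms i).names) ∪ P.fn ∪ Q.fn
  | .cond M N P Q => M.names ∪ N.names ∪ P.fn ∪ Q.fn
  | .event M P => M.names ∪ P.fn

def Proc.NoEvent {n : ℕ} : Proc Sg n → Prop
  | .out _ _ P => P.NoEvent
  | .inp _ P => P.NoEvent
  | .nil => True
  | .par P Q => P.NoEvent ∧ Q.NoEvent
  | .repl P => P.NoEvent
  | .res _ P => P.NoEvent
  | .letd _ _ P Q => P.NoEvent ∧ Q.NoEvent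
  | .cond _ _ P Q => P.NoEvent ∧ Q.NoEvent
  | .event _ _ => False

/-- The process uses only public constructors and public destructors. -/
def Proc.PublicOnly {n : ℕ} : Proc Sg n → Prop
  | .out M N P => M.PublicOnly ∧ N.PublicOnly ∧ P.PublicOnly
  | .inp M P => M.PublicOnly ∧ P.PublicOnly
  | .nil => True
  | .par P Q => P.PublicOnly ∧ Q.PublicOnly
  | .repl P => P.PublicOnly
  | .res _ P => P.PublicOnly
  | .letd g Ms P Q => Sg.desPublic g ∧ (∀ i, (Ms i).PublicOnly) ∧ P.PublicOnly ∧ Q.PublicOnly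
  | .cond M N P Q => M.PublicOnly ∧ N.PublicOnly ∧ P.PublicOnly ∧ Q.PublicOnly
  | .event M P => M.PublicOnly ∧ P.PublicOnly

/-- `Init`-adversaries. -/
structure IsAdversary (Init : Finset Name) (Q : Proc Sg 0) : Prop where
  fn_subset : Q.fn ⊆ (Init : Set Name)
  noEvent : Q.NoEvent
  publicOnly : Q.PublicOnly

end

/-! ### Patterns, facts, substitutions, clauses -/

/-- Name function symbols: one for each name, and the special symbol `b₀`. -/
inductive NameSym : Type
  | ofName (a : Name)
  | b0

/-- Session identifiers in patterns: constants, or variables of `V_s`. -/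
inductive Sid : Type
  | const (l : ℕ)
  | var (i : ℕ)

/-- Patterns. `nm a n ps is` is `a[p₁, …, pₙ, i₁, …, i_{n'}]`; `var x` is a variable of `V_o`. -/
inductive Pat (Sg : Signature.{u, v}) : Type u
  | var (x : ℕ) : Pat Sg
  | nm (a : NameSym) (n : ℕ) (ps : Fin n → Pat Sg) (is : List Sid) : Pat Sg
  | app (f : Sg.Con) (ps : Fin (Sg.conArity f) → Pat Sg) : Pat Sg

/-- `a[]`. -/
def Pat.free (Sg : Signature.{u, v}) (a : Name) : Pat Sg := .nm (.ofName a) 0 Fin.elim0 []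

/-- Facts. -/
inductive PFact (Sg : Signature.{u, v}) : Type u
  | attacker (p : Pat Sg) : PFact Sg
  | message (p q : Pat Sg) : PFact Sg
  | mevent (p : Pat Sg) : PFact Sg
  | event (p : Pat Sg) : PFact Sg

/-- Substitutions: variables of `V_o` are mapped to patterns, variables of `V_s` to session
identifiers. -/
@[ext]
structure Subst (Sg : Signature.{u, v}) : Type u where
  o : ℕ → Pat Sg
  s : ℕ → Sid

/-- Horn clauses `H ⇒ C`, where `H` is a finite multiset of facts. -/
@[ext]
structure Clause (Sg : Signature.{u, v}) : Type u where
  hyps : Multiset (PFact Sg)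
  concl : PFact Sg

section
variable {Sg : Signature.{u, v}}

def Sid.vars : Sid → Set ℕ
  | .const _ => ∅
  | .var i => {i}

def Sid.subst (t : ℕ → Sid) : Sid → Sid
  | .const l => .const l
  | .var i => t i

/-- The variables of `V_o` in a pattern. -/
def Pat.ovars : Pat Sg → Set ℕ
  | .var x => {x}
  | .nm _ _ ps _ => ⋃ i, (ps i).ovars
  | .app _ ps => ⋃ i, (ps i).ovars

/-- The variables of `V_s` in a pattern. -/
def Pat.svars : Pat Sg → Set ℕ
  | .var _ => ∅
  | .nm _ _ ps is => (⋃ i, (ps i).svars) ∪ {x | ∃ j ∈ is, x ∈ j.vars}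
  | .app _ ps => ⋃ i, (ps i).svars

def Pat.subst (σ : Subst Sg) : Pat Sg → Pat Sg
  | .var x => σ.o x
  | .nm a n ps is => .nm a n (fun i => (ps i).subst σ) (is.map (Sid.subst σ.s))
  | .app f ps => .app f (fun i => (ps i).subst σ)

/-- The composition `θ ∘ σ`. -/
def Subst.comp (θ σ : Subst Sg) : Subst Sg where
  o x := (σ.o x).subst θ
  s i := (σ.s i).subst θ.s

def PFact.ovars : PFact Sg → Set ℕ
  | .attacker p => p.ovars
  | .message p q => p.ovars ∪ q.ovars
  | .mevent p => p.ovars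
  | .event p => p.ovars

def PFact.svars : PFact Sg → Set ℕ
  | .attacker p => p.svars
  | .message p q => p.svars ∪ q.svars
  | .mevent p => p.svars
  | .event p => p.svars

def PFact.subst (σ : Subst Sg) : PFact Sg → PFact Sg
  | .attacker p => .attacker (p.subst σ)
  | .message p q => .message (p.subst σ) (q.subst σ)
  | .mevent p => .mevent (p.subst σ)
  | .event p => .event (p.subst σ)

def hypsOvars (H : Multiset (PFact Sg)) : Set ℕ := {x | ∃ F ∈ H, x ∈ F.ovars}

def hypsSvars (H : Multiset (PFact Sg)) : Set ℕ := {x | ∃ F ∈ H, x ∈ F.svars}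

def Clause.ovars (R : Clause Sg) : Set ℕ := hypsOvars R.hyps ∪ R.concl.ovars

def Clause.svars (R : Clause Sg) : Set ℕ := hypsSvars R.hyps ∪ R.concl.svars

def Clause.subst (σ : Subst Sg) (R : Clause Sg) : Clause Sg :=
  ⟨R.hyps.map (PFact.subst σ), R.concl.subst σ⟩

/-- `R₁ ⊒ R₂`: `R₁` subsumes `R₂` (with multiset inclusion of hypotheses). -/
def Clause.Subsumes (R₁ R₂ : Clause Sg) : Prop :=
  ∃ σ : Subst Sg, R₁.concl.subst σ = R₂.concl ∧ R₁.hyps.map (PFact.subst σ) ≤ R₂.hyps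

/-- `σ` is a most general substitution among those that satisfy `U`. -/
def IsMostGeneral (U : Subst Sg → Prop) (σ : Subst Sg) : Prop :=
  U σ ∧ ∀ τ, U τ → ∃ θ : Subst Sg, τ = θ.comp σ

/-- The pattern of a rule term under an assignment of its variables. -/
def RTerm.toPat (s : ℕ → Pat Sg) : Sg.RTm → Pat Sg
  | .var x => s x
  | .app f ts => .app f (fun i => (ts i).toPat s)

/-- The pattern of a term, when names and bound identifiers are mapped to patterns. -/
def Term.eval {n : ℕ} (E : Name → Pat Sg) (ρ : Fin n → Pat Sg) : Term Sg n → Pat Sg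
  | .bvar i => ρ i
  | .name a => E a
  | .app f ts => .app f (fun i => (ts i).eval E ρ)

end

/-! ### Instrumented processes

`IProc Sg n k` has `n` bound identifiers (variables and names) and `k` bound session identifiers
in scope. -/

/-- Session identifiers in instrumented processes: constants or bound session identifiers. -/
inductive SidTerm (k : ℕ) : Type
  | const (l : ℕ) : SidTerm k
  | bvar (i : Fin k) : SidTerm k

/-- Restriction labels: `honest a Ms is` is `a[M₁, …, Mₙ, i₁, …, i_{n'}]`, and `adv a is` is
`b₀[a[i₁, …, i_{n'}]]`. -/
inductive RLabel (Sg : Signature.{u, v}) (n k : ℕ) : Type u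
  | honest (a : Name) (Ms : List (Term Sg n)) (is : List (SidTerm k)) : RLabel Sg n k
  | adv (a : Name) (is : List (SidTerm k)) : RLabel Sg n k

inductive IProc (Sg : Signature.{u, v}) : ℕ → ℕ → Type (max u v)
  | out {n k : ℕ} (M N : Term Sg n) (P : IProc Sg n k) : IProc Sg n k
  | inp {n k : ℕ} (M : Term Sg n) (P : IProc Sg (n + 1) k) : IProc Sg n k
  | nil {n k : ℕ} : IProc Sg n k
  | par {n k : ℕ} (P Q : IProc Sg n k) : IProc Sg n k
  | repl {n k : ℕ} (P : IProc Sg n (k + 1)) : IProc Sg n k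
  | res {n k : ℕ} (ℓ : RLabel Sg n k) (P : IProc Sg (n + 1) k) : IProc Sg n k
  | letd {n k : ℕ} (g : Sg.Des) (Ms : Fin (Sg.desArity g) → Term Sg n)
      (P : IProc Sg (n + 1) k) (Q : IProc Sg n k) : IProc Sg n k
  | cond {n k : ℕ} (M N : Term Sg n) (P Q : IProc Sg n k) : IProc Sg n k
  | event {n k : ℕ} (M : Term Sg n) (P : IProc Sg n k) : IProc Sg n k

section
variable {Sg : Signature.{u, v}}

def SidTerm.subst {k l : ℕ} (t : Fin k → SidTerm l) : SidTerm k → SidTerm l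
  | .const c => .const c
  | .bvar i => t i

def SidTerm.lift {k l : ℕ} (t : Fin k → SidTerm l) : Fin (k + 1) → SidTerm (l + 1) :=
  Fin.cases (.bvar 0) (fun i => (t i).subst (fun j => .bvar j.succ))

def SidTerm.eval {k : ℕ} (ρ : Fin k → Sid) : SidTerm k → Sid
  | .const c => .const c
  | .bvar i => ρ i

def RLabel.subst {n m k l : ℕ} (s : Fin n → Term Sg m) (t : Fin k → SidTerm l) :
    RLabel Sg n k → RLabel Sg m l
  | .honest a Ms is => .honest a (Ms.map (Term.subst s)) (is.map (SidTerm.subst t))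
  | .adv a is => .adv a (is.map (SidTerm.subst t))

/-- The pattern of a restriction label. -/
def RLabel.eval {n k : ℕ} (E : Name → Pat Sg) (ρ : Fin n → Pat Sg) (ρs : Fin k → Sid) :
    RLabel Sg n k → Pat Sg
  | .honest a Ms is =>
      .nm (.ofName a) Ms.length (fun i => (Ms.get i).eval E ρ) (is.map (SidTerm.eval ρs))
  | .adv a is =>
      .nm .b0 1 (fun _ => .nm (.ofName a) 0 Fin.elim0 (is.map (SidTerm.eval ρs))) []

def RLabel.names {n k : ℕ} : RLabel Sg n k → Set Name
  | .honest _ Ms _ => {a | ∃ M ∈ Ms, a ∈ M.names}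
  | .adv _ _ => ∅

def IProc.fn {n k : ℕ} : IProc Sg n k → Set Name
  | .out M N P => M.names ∪ N.names ∪ P.fn
  | .inp M P => M.names ∪ P.fn
  | .nil => ∅
  | .par P Q => P.fn ∪ Q.fn
  | .repl P => P.fn
  | .res ℓ P => ℓ.names ∪ P.fn
  | .letd _ Ms P Q => (⋃ i, (Ms i).names) ∪ P.fn ∪ Q.fn
  | .cond M N P Q => M.names ∪ N.names ∪ P.fn ∪ Q.fn
  | .event M P => M.names ∪ P.fn

/-- Simultaneous substitution of terms for bound identifiers and of session identifiers for bound
session identifiers. -/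
def IProc.subst {n m k l : ℕ} (s : Fin n → Term Sg m) (t : Fin k → SidTerm l) :
    IProc Sg n k → IProc Sg m l
  | .out M N P => .out (M.subst s) (N.subst s) (P.subst s t)
  | .inp M P => .inp (M.subst s) (P.subst (Term.lift s) t)
  | .nil => .nil
  | .par P Q => .par (P.subst s t) (Q.subst s t)
  | .repl P => .repl (P.subst s (SidTerm.lift t))
  | .res ℓ P => .res (ℓ.subst s t) (P.subst (Term.lift s) t)
  | .letd g Ms P Q =>
      .letd g (fun i => (Ms i).subst s) (P.subst (Term.lift s) t) (Q.subst s t)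
  | .cond M N P Q => .cond (M.subst s) (N.subst s) (P.subst s t) (Q.subst s t)
  | .event M P => .event (M.subst s) (P.subst s t)

/-- `P{M/x}`, where `x` is the only free identifier of `P`. -/
def IProc.inst (P : IProc Sg 1 0) (M : Term Sg 0) : IProc Sg 0 0 :=
  P.subst (fun _ => M) SidTerm.bvar

/-- `P{l/i}`, where `i` is the only free session identifier of `P`. -/
def IProc.instSid (P : IProc Sg 0 1) (l : ℕ) : IProc Sg 0 0 :=
  P.subst Term.bvar (fun _ => .const l)

/-- Instrumentation of the process; `t` is the sequence of the variables bound above by inputs and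
by non-deterministic destructor applications, and `s` the sequence of the session identifiers of
the replications above, both from top to bottom. -/
noncomputable def Proc.instrAux {n : ℕ} (P : Proc Sg n) (k : ℕ) (t : List (Fin n))
    (s : List (Fin k)) : IProc Sg n k :=
  match P with
  | .out M N P => .out M N (P.instrAux k t s)
  | .inp M P => .inp M (P.instrAux k (t.map Fin.succ ++ [0]) s)
  | .nil => .nil
  | .par P Q => .par (P.instrAux k t s) (Q.instrAux k t s)
  | .repl P => .repl (P.instrAux (k + 1) t (s.map Fin.succ ++ [0]))
  | .res a P =>
      .res (.honest a (t.map Term.bvar) (s.map SidTerm.bvar)) (P.instrAux k (t.map Fin.succ) s)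
  | .letd g Ms P Q =>
      .letd g Ms
        (P.instrAux k (t.map Fin.succ ++ (open Classical in if NonDet g then [0] else [])) s)
        (Q.instrAux k t s)
  | .cond M N P Q => .cond M N (P.instrAux k t s) (Q.instrAux k t s)
  | .event M P => .event M (P.instrAux k t s)

/-- `instr(P₀)`. -/
noncomputable def instr (P₀ : Proc Sg 0) : IProc Sg 0 0 := P₀.instrAux 0 [] []

/-- Instrumentation of the adversary. -/
def Proc.instrAdvAux {n : ℕ} (P : Proc Sg n) (k : ℕ) (s : List (Fin k)) : IProc Sg n k :=
  match P with
  | .out M N P => .out M N (P.instrAdvAux k s)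
  | .inp M P => .inp M (P.instrAdvAux k s)
  | .nil => .nil
  | .par P Q => .par (P.instrAdvAux k s) (Q.instrAdvAux k s)
  | .repl P => .repl (P.instrAdvAux (k + 1) (s.map Fin.succ ++ [0]))
  | .res a P => .res (.adv a (s.map SidTerm.bvar)) (P.instrAdvAux k s)
  | .letd g Ms P Q => .letd g Ms (P.instrAdvAux k s) (Q.instrAdvAux k s)
  | .cond M N P Q => .cond M N (P.instrAdvAux k s) (Q.instrAdvAux k s)
  | .event M P => .event M (P.instrAdvAux k s)

/-- `instrAdv(Q)`. -/
def instrAdv (Q : Proc Sg 0) : IProc Sg 0 0 := Q.instrAdvAux 0 []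

end

/-! ### Semantics of instrumented processes -/

/-- Environments: partial maps from names to patterns; `pat` matters only on `dom`. -/
structure NEnv (Sg : Signature.{u, v}) : Type u where
  dom : Set Name
  pat : Name → Pat Sg

/-- Semantic configurations `S, E, 𝒫`. -/
structure Config (Sg : Signature.{u, v}) : Type (max u v) where
  S : Set ℕ
  E : NEnv Sg
  procs : Multiset (IProc Sg 0 0)

/-- Atoms (over closed terms). -/
inductive Atom (Sg : Signature.{u, v}) : Type u
  | attacker (M : Term Sg 0) : Atom Sg
  | message (M N : Term Sg 0) : Atom Sg
  | event (M : Term Sg 0) : Atom Sg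

section
variable {Sg : Signature.{u, v}}

def NEnv.term (E : NEnv Sg) (M : Term Sg 0) : Pat Sg := M.eval E.pat Fin.elim0

def NEnv.label (E : NEnv Sg) (ℓ : RLabel Sg 0 0) : Pat Sg := ℓ.eval E.pat Fin.elim0 Fin.elim0

def NEnv.atom (E : NEnv Sg) : Atom Sg → PFact Sg
  | .attacker M => .attacker (E.term M)
  | .message M N => .message (E.term M) (E.term N)
  | .event M => .event (E.term M)

/-- `E[a ↦ p]`. -/
def NEnv.extend (E : NEnv Sg) (a : Name) (p : Pat Sg) : NEnv Sg :=
  ⟨insert a E.dom, Function.update E.pat a p⟩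

/-- The reduction relation on semantic configurations. -/
inductive Red : Config Sg → Config Sg → Prop
  | nil (S : Set ℕ) (E : NEnv Sg) (Ps : Multiset (IProc Sg 0 0)) :
      Red ⟨S, E, Ps + {.nil}⟩ ⟨S, E, Ps⟩
  | repl (S : Set ℕ) (E : NEnv Sg) (Ps : Multiset (IProc Sg 0 0)) (P : IProc Sg 0 1) (l : ℕ)
      (hl : l ∈ S) :
      Red ⟨S, E, Ps + {.repl P}⟩ ⟨S \ {l}, E, Ps + {P.instSid l, .repl P}⟩
  | par (S : Set ℕ) (E : NEnv Sg) (Ps : Multiset (IProc Sg 0 0)) (P Q : IProc Sg 0 0) :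
      Red ⟨S, E, Ps + {.par P Q}⟩ ⟨S, E, Ps + {P, Q}⟩
  | res (S : Set ℕ) (E : NEnv Sg) (Ps : Multiset (IProc Sg 0 0)) (ℓ : RLabel Sg 0 0)
      (P : IProc Sg 1 0) (a : Name) (ha : a ∉ E.dom) :
      Red ⟨S, E, Ps + {.res ℓ P}⟩ ⟨S, E.extend a (E.label ℓ), Ps + {P.inst (.name a)}⟩
  | comm (S : Set ℕ) (E : NEnv Sg) (Ps : Multiset (IProc Sg 0 0)) (N M : Term Sg 0)
      (Q : IProc Sg 0 0) (P : IProc Sg 1 0) :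
      Red ⟨S, E, Ps + {.out N M Q, .inp N P}⟩ ⟨S, E, Ps + {Q, P.inst M}⟩
  | destr₁ (S : Set ℕ) (E : NEnv Sg) (Ps : Multiset (IProc Sg 0 0)) (g : Sg.Des)
      (Ms : Fin (Sg.desArity g) → Term Sg 0) (P : IProc Sg 1 0) (Q : IProc Sg 0 0)
      (M : Term Sg 0) (h : Reduces g Ms M) :
      Red ⟨S, E, Ps + {.letd g Ms P Q}⟩ ⟨S, E, Ps + {P.inst M}⟩
  | destr₂ (S : Set ℕ) (E : NEnv Sg) (Ps : Multiset (IProc Sg 0 0)) (g : Sg.Des)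
      (Ms : Fin (Sg.desArity g) → Term Sg 0) (P : IProc Sg 1 0) (Q : IProc Sg 0 0)
      (h : ¬ ∃ M, Reduces g Ms M) :
      Red ⟨S, E, Ps + {.letd g Ms P Q}⟩ ⟨S, E, Ps + {Q}⟩
  | cond₁ (S : Set ℕ) (E : NEnv Sg) (Ps : Multiset (IProc Sg 0 0)) (M : Term Sg 0)
      (P Q : IProc Sg 0 0) :
      Red ⟨S, E, Ps + {.cond M M P Q}⟩ ⟨S, E, Ps + {P}⟩
  | cond₂ (S : Set ℕ) (E : NEnv Sg) (Ps : Multiset (IProc Sg 0 0)) (M N : Term Sg 0)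
      (P Q : IProc Sg 0 0) (h : M ≠ N) :
      Red ⟨S, E, Ps + {.cond M N P Q}⟩ ⟨S, E, Ps + {Q}⟩
  | event (S : Set ℕ) (E : NEnv Sg) (Ps : Multiset (IProc Sg 0 0)) (M : Term Sg 0)
      (P : IProc Sg 0 0) :
      Red ⟨S, E, Ps + {.event M P}⟩ ⟨S, E, Ps + {P}⟩

end

/-- Traces `cfg 0 → cfg 1 → … → cfg len`. -/
structure Trace (Sg : Signature.{u, v}) : Type (max u v) where
  len : ℕ
  cfg : ℕ → Config Sg
  red : ∀ i < len, Red (cfg i) (cfg (i + 1))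

section
variable {Sg : Signature.{u, v}}

/-- The trace contains the reduction `c → d`. -/
def Trace.Contains (T : Trace Sg) (c d : Config Sg) : Prop :=
  ∃ i < T.len, T.cfg i = c ∧ T.cfg (i + 1) = d

def Trace.SatAtom (Init : Finset Name) (T : Trace Sg) : Atom Sg → Prop
  | .attacker M => ∃ S E Ps c Q P, c ∈ Init ∧
      T.Contains ⟨S, E, Ps + {.out (.name c) M Q, .inp (.name c) P}⟩ ⟨S, E, Ps + {Q, P.inst M}⟩
  | .message N M => ∃ S E Ps Q P,
      T.Contains ⟨S, E, Ps + {.out N M Q, .inp N P}⟩ ⟨S, E, Ps + {Q, P.inst M}⟩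
  | .event M => ∃ S E Ps P,
      T.Contains ⟨S, E, Ps + {.event M P}⟩ ⟨S, E, Ps + {P}⟩

/-- The trace satisfies the fact `F`: it satisfies an atom that the last environment maps to `F`.
(No trace satisfies a fact `mevent p`.) -/
def Trace.SatFact (Init : Finset Name) (T : Trace Sg) (F : PFact Sg) : Prop :=
  ∃ α : Atom Sg, T.SatAtom Init α ∧ (T.cfg T.len).E.atom α = F

/-- The instrumented process `P'` satisfies the correspondence
`F ⇒ ⋁ⱼ (Fⱼ ⇝ ⋀ₖ event(pⱼₖ))` against `Init`-adversaries. -/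
def SatisfiesCorrespondence (Init : Finset Name) (P' : IProc Sg 0 0) (F : PFact Sg) {m : ℕ}
    (l : Fin m → ℕ) (Fj : Fin m → PFact Sg) (p : (j : Fin m) → Fin (l j) → Pat Sg) : Prop :=
  ∀ Q : Proc Sg 0, IsAdversary Init Q →
  ∀ (S₀ : Set ℕ) (E₀ : NEnv Sg), P'.fn ∪ (Init : Set Name) ⊆ E₀.dom →
  (∀ a ∈ E₀.dom, E₀.pat a = Pat.free Sg a) →
  ∀ T : Trace Sg, T.cfg 0 = ⟨S₀, E₀, {P', instrAdv Q}⟩ →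
  ∀ σ : Subst Sg, T.SatFact Init (F.subst σ) →
  ∃ (σ' : Subst Sg) (j : Fin m), (Fj j).subst σ' = F.subst σ ∧
    ∀ k : Fin (l j), T.SatFact Init (.event ((p j k).subst σ'))

end

/-! ### Generation of clauses -/

/-- Environments `ρ` of the translation. Free names `a` are always mapped to `a[]`. -/
structure TEnv (Sg : Signature.{u, v}) (n k : ℕ) : Type u where
  o : Fin n → Pat Sg
  s : Fin k → Sid

section
variable {Sg : Signature.{u, v}}

def TEnv.ovars {n k : ℕ} (ρ : TEnv Sg n k) : Set ℕ := ⋃ i, (ρ.o i).ovars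

def TEnv.svars {n k : ℕ} (ρ : TEnv Sg n k) : Set ℕ := (⋃ i, (ρ.o i).svars) ∪ ⋃ i, (ρ.s i).vars

def TEnv.term {n k : ℕ} (ρ : TEnv Sg n k) (M : Term Sg n) : Pat Sg := M.eval (Pat.free Sg) ρ.o

def TEnv.subst {n k : ℕ} (σ : Subst Sg) (ρ : TEnv Sg n k) : TEnv Sg n k :=
  ⟨fun i => (ρ.o i).subst σ, fun i => (ρ.s i).subst σ.s⟩

/-- `ρ[x ↦ p]` for a newly bound variable or name `x`. -/
def TEnv.cons {n k : ℕ} (p : Pat Sg) (ρ : TEnv Sg n k) : TEnv Sg (n + 1) k :=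
  ⟨Fin.cases p ρ.o, ρ.s⟩

/-- `ρ[i ↦ j]` for a newly bound session identifier `i`. -/
def TEnv.consSid {n k : ℕ} (j : Sid) (ρ : TEnv Sg n k) : TEnv Sg n (k + 1) :=
  ⟨ρ.o, Fin.cases j ρ.s⟩

/-- `(σ, σ')` is a most general pair of substitutions such that `σ(pᵢ) = σ'(p'ᵢ)` for all `i`,
where the `p'ᵢ` are the arguments of the rule `r`; `σ` acts on the variables of `ρ` and `H`, and
`σ'` on those of the rule. -/
def IsMostGeneralPair {n k d : ℕ} (ρ : TEnv Sg n k) (H : Multiset (PFact Sg)) (ps : Fin d → Pat Sg)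
    (r : Rule Sg.Con Sg.conArity d) (σ : Subst Sg) (σ' : ℕ → Pat Sg) : Prop :=
  (∀ i, (ps i).subst σ = (r.lhs i).toPat σ') ∧
  ∀ (τ : Subst Sg) (τ' : ℕ → Pat Sg), (∀ i, (ps i).subst τ = (r.lhs i).toPat τ') →
    ∃ θ : Subst Sg,
      (∀ x ∈ ρ.ovars ∪ hypsOvars H, τ.o x = (σ.o x).subst θ) ∧
      (∀ x ∈ ρ.svars ∪ hypsSvars H, τ.s x = (σ.s x).subst θ.s) ∧
      (∀ i, ∀ x ∈ (r.lhs i).vars, τ' x = (σ' x).subst θ)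

/-- `IsTransl P ρ H 𝒮`: `𝒮` is the set of clauses `[[P]]ρH`. It is unique up to the choice of the
variables that stand for bound variables and session identifiers (any fresh ones) and of the most
general unifiers. -/
def IsTransl {n k : ℕ} : IProc Sg n k → TEnv Sg n k → Multiset (PFact Sg) → Set (Clause Sg) → Prop
  | .nil, _, _, 𝒮 => 𝒮 = ∅
  | .par P Q, ρ, H, 𝒮 =>
      ∃ 𝒮₁ 𝒮₂, IsTransl P ρ H 𝒮₁ ∧ IsTransl Q ρ H 𝒮₂ ∧ 𝒮 = 𝒮₁ ∪ 𝒮₂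
  | .repl P, ρ, H, 𝒮 =>
      ∃ i, i ∉ ρ.svars ∪ hypsSvars H ∧ IsTransl P (ρ.consSid (.var i)) H 𝒮
  | .res ℓ P, ρ, H, 𝒮 => IsTransl P (ρ.cons (ℓ.eval (Pat.free Sg) ρ.o ρ.s)) H 𝒮
  | .inp M P, ρ, H, 𝒮 =>
      ∃ x, x ∉ ρ.ovars ∪ hypsOvars H ∧
        IsTransl P (ρ.cons (.var x)) (H + {.message (ρ.term M) (.var x)}) 𝒮
  | .out M N P, ρ, H, 𝒮 =>
      ∃ 𝒮₁, IsTransl P ρ H 𝒮₁ ∧ 𝒮 = 𝒮₁ ∪ {⟨H, .message (ρ.term M) (ρ.term N)⟩}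
  | .letd g Ms P Q, ρ, H, 𝒮 =>
      ∃ (𝒮₁ : Rule Sg.Con Sg.conArity (Sg.desArity g) → Set (Clause Sg)) (𝒮₂ : Set (Clause Sg)),
        (∀ r ∈ Sg.rules g,
          ((∃ (σ : Subst Sg) (σ' : ℕ → Pat Sg),
              IsMostGeneralPair ρ H (fun i => ρ.term (Ms i)) r σ σ' ∧
              IsTransl P ((ρ.subst σ).cons (r.rhs.toPat σ')) (H.map (PFact.subst σ)) (𝒮₁ r)) ∨
            ((¬ ∃ (τ : Subst Sg) (τ' : ℕ → Pat Sg),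
              ∀ i, (ρ.term (Ms i)).subst τ = (r.lhs i).toPat τ') ∧ 𝒮₁ r = ∅))) ∧
        IsTransl Q ρ H 𝒮₂ ∧ 𝒮 = (⋃ r ∈ Sg.rules g, 𝒮₁ r) ∪ 𝒮₂
  | .cond M N P Q, ρ, H, 𝒮 =>
      ∃ 𝒮₁ 𝒮₂ : Set (Clause Sg),
        ((∃ σ : Subst Sg,
            IsMostGeneral (fun τ => (ρ.term M).subst τ = (ρ.term N).subst τ) σ ∧
            IsTransl P (ρ.subst σ) (H.map (PFact.subst σ)) 𝒮₁) ∨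
          ((¬ ∃ τ : Subst Sg, (ρ.term M).subst τ = (ρ.term N).subst τ) ∧ 𝒮₁ = ∅)) ∧
        IsTransl Q ρ H 𝒮₂ ∧ 𝒮 = 𝒮₁ ∪ 𝒮₂
  | .event M P, ρ, H, 𝒮 =>
      ∃ 𝒮₁, IsTransl P ρ (H + {.mevent (ρ.term M)}) 𝒮₁ ∧
        𝒮 = 𝒮₁ ∪ {⟨H, .event (ρ.term M)⟩}

/-- The clause `attacker(x₁) ∧ … ∧ attacker(xₙ) ⇒ attacker(f(x₁, …, xₙ))`. -/
def clauseRf (f : Sg.Con) (x : Fin (Sg.conArity f) → ℕ) : Clause Sg :=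
  ⟨Finset.univ.val.map (fun i => .attacker (.var (x i))),
    .attacker (.app f (fun i => .var (x i)))⟩

/-- The clause `attacker(M₁) ∧ … ∧ attacker(Mₙ) ⇒ attacker(M)` of a rule of a destructor. -/
def clauseRg {d : ℕ} (r : Rule Sg.Con Sg.conArity d) : Clause Sg :=
  ⟨Finset.univ.val.map (fun i => .attacker ((r.lhs i).toPat Pat.var)),
    .attacker (r.rhs.toPat Pat.var)⟩

/-- The clauses for the attacker: (Init), (Rn), (Rf), (Rg), (Rl), (Rs). -/
inductive AttackerClause (Init : Finset Name) : Clause Sg → Prop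
  | init (a : Name) (ha : a ∈ Init) : AttackerClause Init ⟨0, .attacker (Pat.free Sg a)⟩
  | rn : AttackerClause Init ⟨0, .attacker (.nm .b0 1 (fun _ => .var 0) [])⟩
  | rf (f : Sg.Con) (hf : Sg.conPublic f) : AttackerClause Init (clauseRf f (fun i => i))
  | rg (g : Sg.Des) (hg : Sg.desPublic g) (r : Rule Sg.Con Sg.conArity (Sg.desArity g))
      (hr : r ∈ Sg.rules g) : AttackerClause Init (clauseRg r)
  | rl : AttackerClause Init ⟨{.message (.var 0) (.var 1), .attacker (.var 0)}, .attacker (.var 1)⟩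
  | rs : AttackerClause Init ⟨{.attacker (.var 0), .attacker (.var 1)}, .message (.var 0) (.var 1)⟩

/-- `𝓡₀` is the set of clauses that corresponds to the instrumented process `P'`. -/
def IsClauseSet (P' : IProc Sg 0 0) (Init : Finset Name) (𝓡₀ : Set (Clause Sg)) : Prop :=
  ∃ 𝒮, IsTransl P' ⟨Fin.elim0, Fin.elim0⟩ 0 𝒮 ∧ 𝓡₀ = 𝒮 ∪ {R | AttackerClause Init R}

/-! ### Resolution and selection -/

/-- The renaming of variables given by permutations of `V_o` and `V_s`. -/
def renSubst (π πs : Equiv.Perm ℕ) : Subst Sg := ⟨fun x => .var (π x), fun i => .var (πs i)⟩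

/-- `R ∘_{F₀} R'` is defined: the conclusion of `R` unifies with the hypothesis `F₀` of `R'`
(the variables of `R` and `R'` being considered as distinct). -/
def Resolvable (R : Clause Sg) (F₀ : PFact Sg) (R' : Clause Sg) : Prop :=
  F₀ ∈ R'.hyps ∧ ∃ σ τ : Subst Sg, R.concl.subst σ = F₀.subst τ

open Classical in
/-- `R'' = R ∘_{F₀} R'`: the variables of `R` are renamed apart from those of `R'`, giving
`R₁ = H₁ ⇒ C₁`, and `R'' = σ(H₁ ∪ (H' \ {F₀})) ⇒ σC'`, where `σ` is a most general unifier of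
`C₁` and `F₀`. -/
def IsResolvent (R : Clause Sg) (F₀ : PFact Sg) (R' R'' : Clause Sg) : Prop :=
  F₀ ∈ R'.hyps ∧ ∃ (π πs : Equiv.Perm ℕ) (R₁ : Clause Sg) (σ : Subst Sg),
    R₁ = R.subst (renSubst π πs) ∧ Disjoint R₁.ovars R'.ovars ∧ Disjoint R₁.svars R'.svars ∧
    IsMostGeneral (fun τ => R₁.concl.subst τ = F₀.subst τ) σ ∧
    R'' = ⟨(R₁.hyps + R'.hyps.erase F₀).map (PFact.subst σ), R'.concl.subst σ⟩

def Unselectable (F : PFact Sg) : Prop :=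
  (∃ x, F = .attacker (.var x)) ∨ ∃ p, F = .mevent p

end

/-- Selection functions. -/
structure SelectionFunction (Sg : Signature.{u, v}) where
  sel : Clause Sg → Set (PFact Sg)
  subset_hyps : ∀ R, ∀ F ∈ sel R, F ∈ R.hyps
  selectable : ∀ R, ∀ F ∈ sel R, ¬ Unselectable F
  nonempty : ∀ R, (∃ x, R.concl = .attacker (.var x)) → (∃ F ∈ R.hyps, ¬ Unselectable F) →
    (sel R).Nonempty

section
variable {Sg : Signature.{u, v}}

/-! ### Simplification of clauses -/

open Classical in
/-- Recursive decomposition of the data constructors at the root of a pattern. -/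
noncomputable def Pat.decomp : Pat Sg → Multiset (Pat Sg)
  | .var x => {.var x}
  | .nm a n ps is => {.nm a n ps is}
  | .app f ps => if Sg.IsData f then ∑ i, (ps i).decomp else {.app f ps}

/-- Decomposition of a fact `attacker(f(…))` with a data constructor `f`. -/
noncomputable def PFact.decomp : PFact Sg → Multiset (PFact Sg)
  | .attacker p => p.decomp.map PFact.attacker
  | F => {F}

/-- The clauses (Rf) and (Rg) for data constructors, up to renaming. -/
def IsDataClause (R : Clause Sg) : Prop :=
  ∃ f, Sg.IsData f ∧ ∃ x : Fin (Sg.conArity f) → ℕ, Function.Injective x ∧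
    (R = clauseRf f x ∨
      ∃ i, R = ⟨{.attacker (.app f (fun j => .var (x j)))}, .attacker (.var (x i))⟩)

open Classical in
noncomputable def decompHyp (R : Clause Sg) : Clause Sg :=
  if IsDataClause R then R else ⟨R.hyps.bind PFact.decomp, R.concl⟩

open Classical in
noncomputable def decompAll (R : Clause Sg) : Set (Clause Sg) :=
  if IsDataClause R then {R} else {R' | ∃ C ∈ R.concl.decomp, R' = ⟨R.hyps.bind PFact.decomp, C⟩}

open Classical in
noncomputable def elimDup (R : Clause Sg) : Clause Sg := ⟨R.hyps.dedup, R.concl⟩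

/-- One elimination of redundant hypotheses: `H ∧ H' ⇒ C` becomes `H' ⇒ C` when `σH ⊆ H'` for
some `σ` that does not change the variables of `H'` and `C`. -/
def RedundantHypStep (R R' : Clause Sg) : Prop :=
  R'.concl = R.concl ∧ ∃ (H : Multiset (PFact Sg)) (σ : Subst Sg), R.hyps = H + R'.hyps ∧
    (∀ F ∈ H, F.subst σ ∈ R'.hyps) ∧
    (∀ x ∈ R'.ovars, σ.o x = .var x) ∧ (∀ i ∈ R'.svars, σ.s i = .var i)

/-- `elimredundanthyp`. As the elimination is optional, any number of steps is allowed. -/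
def ElimRedundantHyp : Clause Sg → Clause Sg → Prop := Relation.ReflTransGen RedundantHypStep

/-- The clause is removed by `elimnot`. -/
def ForbiddenBy (Fnot : Set (PFact Sg)) (R : Clause Sg) : Prop :=
  ∃ F ∈ R.hyps, ∃ F' ∈ Fnot, ∃ σ : Subst Sg, F = F'.subst σ

/-- The clause is removed by `elimtaut`. -/
def Tautology (R : Clause Sg) : Prop := R.concl ∈ R.hyps

open Classical in
/-- Removal of the hypotheses `attacker(x)` such that `x` does not occur elsewhere. -/
noncomputable def elimAttX (R : Clause Sg) : Clause Sg :=
  ⟨R.hyps.filter (fun F => ¬ ∃ x, F = .attacker (.var x) ∧ x ∉ R.concl.ovars ∧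
    x ∉ hypsOvars (R.hyps.erase F)), R.concl⟩

/-- `𝒮 = simplify(R)`, for
`simplify = elimattx ∘ elimtaut ∘ elimnot ∘ elimredundanthyp ∘ elimdup ∘ decomp`. -/
def Simplify (Fnot : Set (PFact Sg)) (R : Clause Sg) (𝒮 : Set (Clause Sg)) : Prop :=
  ∃ r : Clause Sg → Clause Sg, (∀ R' ∈ decompAll R, ElimRedundantHyp (elimDup R') (r R')) ∧
    𝒮 = {R'' | ∃ R' ∈ decompAll R, ¬ ForbiddenBy Fnot (r R') ∧ ¬ Tautology (r R') ∧
      R'' = elimAttX (r R')}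

/-- `𝒮 = simplify'(R)`, for
`simplify' = elimattx ∘ elimnot ∘ elimredundanthyp ∘ elimdup ∘ decomphyp`. -/
def SimplifyHyp (Fnot : Set (PFact Sg)) (R : Clause Sg) (𝒮 : Set (Clause Sg)) : Prop :=
  ∃ R', ElimRedundantHyp (elimDup (decompHyp R)) R' ∧
    𝒮 = {R'' | ¬ ForbiddenBy Fnot R' ∧ R'' = elimAttX R'}

/-! ### The solving algorithm -/

/-- `𝓡' = elim(𝓡)`: removal of the clauses that are subsumed by another clause of the set (of two
clauses that subsume each other, one is kept). -/
def IsElim (𝓡 𝓡' : Set (Clause Sg)) : Prop :=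
  𝓡' ⊆ 𝓡 ∧ (∀ R ∈ 𝓡, ∃ R' ∈ 𝓡', R'.Subsumes R) ∧
    ∀ R ∈ 𝓡', ∀ R' ∈ 𝓡', R'.Subsumes R → R' = R

/-- The assignment `𝓡 ← elim(simplify(R) ∪ 𝓡)` changes `𝓡` into `𝓡'`. -/
def AddClause (Fnot : Set (PFact Sg)) (R : Clause Sg) (𝓡 𝓡' : Set (Clause Sg)) : Prop :=
  ∃ 𝒮, Simplify Fnot R 𝒮 ∧ IsElim (𝒮 ∪ 𝓡) 𝓡'

/-- The successive insertion of the clauses of a list. -/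
inductive AddClauses (Fnot : Set (PFact Sg)) :
    List (Clause Sg) → Set (Clause Sg) → Set (Clause Sg) → Prop
  | nil (𝓡 : Set (Clause Sg)) : AddClauses Fnot [] 𝓡 𝓡
  | cons (R : Clause Sg) (L : List (Clause Sg)) (𝓡 𝓡' 𝓡'' : Set (Clause Sg))
      (h : AddClause Fnot R 𝓡 𝓡') (hL : AddClauses Fnot L 𝓡' 𝓡'') :
      AddClauses Fnot (R :: L) 𝓡 𝓡''

/-- One iteration of the second step of the saturation. -/
def SaturationStep (s : SelectionFunction Sg) (Fnot : Set (PFact Sg)) (𝓡 𝓡' : Set (Clause Sg)) :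
    Prop :=
  ∃ R ∈ 𝓡, s.sel R = ∅ ∧ ∃ R' ∈ 𝓡, ∃ F₀ ∈ s.sel R', ∃ R'',
    IsResolvent R F₀ R' R'' ∧ AddClause Fnot R'' 𝓡 𝓡'

/-- The iteration has reached a fixpoint: no resolution changes `𝓡`. -/
def IsFixpoint (s : SelectionFunction Sg) (Fnot : Set (PFact Sg)) (𝓡 : Set (Clause Sg)) : Prop :=
  ∀ R ∈ 𝓡, s.sel R = ∅ → ∀ R' ∈ 𝓡, ∀ F₀ ∈ s.sel R', Resolvable R F₀ R' →
    ∃ R'', IsResolvent R F₀ R' R'' ∧ AddClause Fnot R'' 𝓡 𝓡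

/-- `saturate(𝓡₀)` terminates and returns `𝓡₁`. The clauses of `𝓡₀` are inserted in any order. -/
def Saturates (s : SelectionFunction Sg) (Fnot : Set (PFact Sg)) (𝓡₀ 𝓡₁ : Set (Clause Sg)) :
    Prop :=
  ∃ (L : List (Clause Sg)) (𝓡 𝓡' : Set (Clause Sg)), (∀ R, R ∈ L ↔ R ∈ 𝓡₀) ∧
    AddClauses Fnot L ∅ 𝓡 ∧ Relation.ReflTransGen (SaturationStep s Fnot) 𝓡 𝓡' ∧
    IsFixpoint s Fnot 𝓡' ∧ 𝓡₁ = {R ∈ 𝓡' | s.sel R = ∅}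

/-- `Deriv s Fnot 𝓡₁ R 𝓡 𝒟`: the call `deriv(R, 𝓡, 𝓡₁)` terminates and returns the set `𝒟`. In the
third case, `next R' F₀` is `simplify'(R' ∘_{F₀} R)`, and `out R' F₀ R''` is the result of the
recursive call on the element `R''` of this set. -/
inductive Deriv (s : SelectionFunction Sg) (Fnot : Set (PFact Sg)) (𝓡₁ : Set (Clause Sg)) :
    Clause Sg → Set (Clause Sg) → Set (Clause Sg) → Prop
  | seen (R : Clause Sg) (𝓡 : Set (Clause Sg)) (h : ∃ R' ∈ 𝓡, R'.Subsumes R) :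
      Deriv s Fnot 𝓡₁ R 𝓡 ∅
  | done (R : Clause Sg) (𝓡 : Set (Clause Sg)) (h : ¬ ∃ R' ∈ 𝓡, R'.Subsumes R)
      (hs : s.sel R = ∅) : Deriv s Fnot 𝓡₁ R 𝓡 {R}
  | step (R : Clause Sg) (𝓡 : Set (Clause Sg)) (h : ¬ ∃ R' ∈ 𝓡, R'.Subsumes R)
      (hs : s.sel R ≠ ∅) (next : Clause Sg → PFact Sg → Set (Clause Sg))
      (out : Clause Sg → PFact Sg → Clause Sg → Set (Clause Sg))
      (hnext : ∀ R' ∈ 𝓡₁, ∀ F₀ ∈ s.sel R, Resolvable R' F₀ R →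
        ∃ R'', IsResolvent R' F₀ R R'' ∧ SimplifyHyp Fnot R'' (next R' F₀))
      (hout : ∀ R' ∈ 𝓡₁, ∀ F₀ ∈ s.sel R, Resolvable R' F₀ R → ∀ R'' ∈ next R' F₀,
        Deriv s Fnot 𝓡₁ R'' ({R} ∪ 𝓡) (out R' F₀ R'')) :
      Deriv s Fnot 𝓡₁ R 𝓡
        {C | ∃ R' ∈ 𝓡₁, ∃ F₀ ∈ s.sel R, Resolvable R' F₀ R ∧ ∃ R'' ∈ next R' F₀, C ∈ out R' F₀ R''}

/-- `derivable(F, 𝓡₁)` terminates and returns `𝒟`. -/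
def Derivable (s : SelectionFunction Sg) (Fnot : Set (PFact Sg)) (F : PFact Sg)
    (𝓡₁ 𝒟 : Set (Clause Sg)) : Prop :=
  Deriv s Fnot 𝓡₁ ⟨{F}, F⟩ ∅ 𝒟

/-- `solve_{P', Init}(F)` terminates without error and returns `𝒟`. -/
def Solves (s : SelectionFunction Sg) (Fnot : Set (PFact Sg)) (P' : IProc Sg 0 0)
    (Init : Finset Name) (F : PFact Sg) (𝒟 : Set (Clause Sg)) : Prop :=
  ∃ 𝓡₀ 𝓡₁, IsClauseSet P' Init 𝓡₀ ∧ Saturates s Fnot 𝓡₀ 𝓡₁ ∧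
    (∀ F' ∈ Fnot, Derivable s Fnot F' 𝓡₁ ∅) ∧ Derivable s Fnot F 𝓡₁ 𝒟

end

end PV

namespace PV

section
variable {Sg : Signature.{u, v}}

/-! ### Substitution lemmas -/

/-! The proof joins a soundness statement about processes to a completeness statement about
resolution. The link is `Der`: the facts derivable from the clauses together with m-event(p) for
every event(p) that the trace satisfies.

Soundness (`Trace.SatFact.der`): every fact satisfied by the trace is derivable. This is a
type-soundness argument, in which `Typed` reads a set of facts as a type system. Closure under the
clauses of the process makes the process well typed (`IsTransl.typed`), closure under the attacker
clauses makes every adversary well typed (`adversary_typed`), and reduction preserves typing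
(`Red.ok`). Passing an event requires its m-event fact, which is available because the trace
executes that event.

Completeness (`Solves.exists_inst`): every derivable instance of the query is the conclusion of an
instance of a returned clause with derivable hypotheses. No clause concludes an m-event fact, so the
m-event hypotheses of that instance are events of the trace. With the assumed shape of the returned
clauses, this is the correspondence.

Completeness is proved by weights instead of transformations of derivation trees. Attacker facts are
cut into components by removing data constructors; a component weighs as much as its cheapest
derivation (`minWt`), and a fact weighs the sum of its components plus the number of constructors
removed. Using a clause costs 1, plus 2 for each data constructor stripped from its conclusion, plus
the weight of its hypotheses. Resolution on a selected hypothesis strictly lowers the cost, while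
simplification and subsumption preserve every cost bound, so at the fixpoint a cheapest clause has
no selected hypothesis (`IsFixpoint.exists_inst`). The same descent shows that the backward search
never cuts the branch that matters (`Deriv.exists_inst`).

Pruning by `Fnot` looks circular, since it is justified by searches that run on pruned clauses. An
induction on weight breaks the circle: pruning is harmless below the least weight of a derivable
forbidden instance, so the search for that fact would have returned a clause
(`not_drv_of_deriv_empty`). -/

theorem RTerm.toPat_subst (σ : Subst Sg) (s : ℕ → Pat Sg) (t : Sg.RTm) :
    (t.toPat s).subst σ = t.toPat (fun x => (s x).subst σ) := by
  induction t with
  | var x => rfl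
  | app f ts ih => simp only [RTerm.toPat, Pat.subst, ih]

theorem RTerm.toPat_congr {s s' : ℕ → Pat Sg} (t : Sg.RTm) (h : ∀ x ∈ t.vars, s x = s' x) :
    t.toPat s = t.toPat s' := by
  induction t with
  | var x => exact h x rfl
  | app f ts ih =>
    simp only [RTerm.toPat]
    congr 1
    funext i
    exact ih i fun x hx => h x (Set.mem_iUnion.2 ⟨i, hx⟩)

theorem Sid.subst_congr {s t : ℕ → Sid} (j : Sid) (h : ∀ i ∈ j.vars, s i = t i) :
    j.subst s = j.subst t := by
  cases j with
  | const l => rfl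
  | var i => exact h i rfl

theorem Sid.subst_subst (s t : ℕ → Sid) (j : Sid) :
    (j.subst s).subst t = j.subst (fun i => (s i).subst t) := by
  cases j <;> rfl

theorem Pat.subst_congr {σ τ : Subst Sg} (p : Pat Sg) (ho : ∀ x ∈ p.ovars, σ.o x = τ.o x)
    (hs : ∀ i ∈ p.svars, σ.s i = τ.s i) : p.subst σ = p.subst τ := by
  induction p with
  | var x => exact ho x rfl
  | nm a n ps is ih =>
    simp only [Pat.subst]
    congr 1
    · funext i
      exact ih i (fun x hx => ho x (Set.mem_iUnion.2 ⟨i, hx⟩))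
        (fun x hx => hs x (Or.inl (Set.mem_iUnion.2 ⟨i, hx⟩)))
    · exact List.map_congr_left fun j hj =>
        Sid.subst_congr j fun i hi => hs i (Or.inr ⟨j, hj, hi⟩)
  | app f ps ih =>
    simp only [Pat.subst]
    congr 1
    funext i
    exact ih i (fun x hx => ho x (Set.mem_iUnion.2 ⟨i, hx⟩))
      (fun x hx => hs x (Set.mem_iUnion.2 ⟨i, hx⟩))

theorem Pat.subst_comp (θ σ : Subst Sg) (p : Pat Sg) :
    p.subst (θ.comp σ) = (p.subst σ).subst θ := by
  induction p with
  | var x => rfl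
  | nm a n ps is ih =>
    simp only [Pat.subst, ih, List.map_map]
    congr 1
    exact List.map_congr_left fun j _ => (Sid.subst_subst σ.s θ.s j).symm
  | app f ps ih => simp only [Pat.subst, ih]

theorem PFact.subst_congr {σ τ : Subst Sg} (F : PFact Sg) (ho : ∀ x ∈ F.ovars, σ.o x = τ.o x)
    (hs : ∀ i ∈ F.svars, σ.s i = τ.s i) : F.subst σ = F.subst τ := by
  cases F with
  | message p q =>
    simp only [PFact.subst]
    rw [Pat.subst_congr p (fun x hx => ho x (Or.inl hx)) (fun x hx => hs x (Or.inl hx)),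
      Pat.subst_congr q (fun x hx => ho x (Or.inr hx)) (fun x hx => hs x (Or.inr hx))]
  | _ p =>
    simp only [PFact.subst]
    rw [Pat.subst_congr p ho hs]

theorem PFact.subst_comp (θ σ : Subst Sg) (F : PFact Sg) :
    F.subst (θ.comp σ) = (F.subst σ).subst θ := by
  cases F <;> simp only [PFact.subst, Pat.subst_comp]

theorem Pat.free_subst (σ : Subst Sg) (a : Name) : (Pat.free Sg a).subst σ = Pat.free Sg a := by
  simp only [Pat.free, Pat.subst, List.map_nil]
  congr 1
  funext i
  exact i.elim0

theorem Term.eval_psubst {n : ℕ} (E : Name → Pat Sg) (ρ : Fin n → Pat Sg) (σ : Subst Sg)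
    (hE : ∀ a, (E a).subst σ = E a) (M : Term Sg n) :
    (M.eval E ρ).subst σ = M.eval E (fun i => (ρ i).subst σ) := by
  induction M with
  | bvar i => rfl
  | name a => exact hE a
  | app f ts ih => simp only [Term.eval, Pat.subst, ih]

theorem Term.eval_congr {n : ℕ} {E E' : Name → Pat Sg} (ρ : Fin n → Pat Sg) (M : Term Sg n)
    (h : ∀ a ∈ M.names, E a = E' a) : M.eval E ρ = M.eval E' ρ := by
  induction M with
  | bvar i => rfl
  | name a => exact h a rfl
  | app f ts ih =>
    simp only [Term.eval]
    congr 1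
    funext i
    exact ih i fun a ha => h a (Set.mem_iUnion.2 ⟨i, ha⟩)

theorem Term.eval_tsubst {n m : ℕ} (E : Name → Pat Sg) (ρ : Fin m → Pat Sg)
    (s : Fin n → Term Sg m) (M : Term Sg n) :
    (M.subst s).eval E ρ = M.eval E (fun i => (s i).eval E ρ) := by
  induction M with
  | bvar i => rfl
  | name a => rfl
  | app f ts ih => simp only [Term.eval, Term.subst, ih]

theorem Term.names_subst {n m : ℕ} (s : Fin n → Term Sg m) (M : Term Sg n) (a : Name)
    (h : a ∈ (M.subst s).names) : a ∈ M.names ∨ ∃ i, a ∈ (s i).names := by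
  induction M with
  | bvar i => exact Or.inr ⟨i, h⟩
  | name b => exact Or.inl h
  | app f ts ih =>
    obtain ⟨i, hi⟩ := Set.mem_iUnion.1 h
    exact (ih i hi).imp_left fun h => Set.mem_iUnion.2 ⟨i, h⟩

theorem RTerm.toTerm_eval {n : ℕ} (E : Name → Pat Sg) (ρ : Fin n → Pat Sg) (s : ℕ → Term Sg n)
    (t : Sg.RTm) : (t.toTerm s).eval E ρ = t.toPat (fun x => (s x).eval E ρ) := by
  induction t with
  | var x => rfl
  | app f ts ih => simp only [RTerm.toPat, RTerm.toTerm, Term.eval, ih]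

theorem RTerm.mem_names_toTerm {n : ℕ} (s : ℕ → Term Sg n) (t : Sg.RTm) (a : Name) :
    a ∈ (t.toTerm s).names ↔ ∃ x ∈ t.vars, a ∈ (s x).names := by
  induction t with
  | var x => simp [RTerm.toTerm, RTerm.vars]
  | app f ts ih =>
    simp only [RTerm.toTerm, RTerm.vars, Term.names, Set.mem_iUnion, ih]
    constructor
    · rintro ⟨i, x, hx, h⟩
      exact ⟨x, ⟨i, hx⟩, h⟩
    · rintro ⟨x, ⟨i, hx⟩, h⟩
      exact ⟨i, x, hx, h⟩

/-- Rules contain no names and their right-hand sides introduce no variables, so a result only has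
names of the arguments. -/
theorem Reduces.names_subset {n : ℕ} {g : Sg.Des} {Ms : Fin (Sg.desArity g) → Term Sg n}
    {M : Term Sg n} (h : Reduces g Ms M) (a : Name) (ha : a ∈ M.names) :
    ∃ i, a ∈ (Ms i).names := by
  obtain ⟨r, _, s, hs, rfl⟩ := h
  obtain ⟨x, hx, hax⟩ := (RTerm.mem_names_toTerm s _ a).1 ha
  obtain ⟨i, hi⟩ := Set.mem_iUnion.1 (r.rhs_vars hx)
  exact ⟨i, by rw [hs i]; exact (RTerm.mem_names_toTerm s _ a).2 ⟨x, hi, hax⟩⟩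

/-- The arity indexes the type of the argument family, and the arity of a substituted label is the
length of a mapped list, equal to the original one only propositionally. -/
theorem Pat.nm_congr {a : NameSym} {n m : ℕ} (h : n = m) {ps : Fin n → Pat Sg}
    {qs : Fin m → Pat Sg} (hp : ∀ i, ps i = qs (Fin.cast h i)) (is : List Sid) :
    Pat.nm a n ps is = Pat.nm a m qs is := by
  subst h
  congr 1
  funext i
  exact hp i

theorem SidTerm.eval_subst {k l : ℕ} (t : Fin k → SidTerm l) (ρ : Fin l → Sid) (j : SidTerm k) :
    (j.subst t).eval ρ = j.eval (fun i => (t i).eval ρ) := by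
  cases j <;> rfl

theorem SidTerm.eval_psubst {k : ℕ} (ρ : Fin k → Sid) (s : ℕ → Sid) (j : SidTerm k) :
    (j.eval ρ).subst s = j.eval (fun i => (ρ i).subst s) := by
  cases j <;> rfl

theorem RLabel.eval_tsubst {n m k l : ℕ} (E : Name → Pat Sg) (ρ : Fin m → Pat Sg)
    (ρs : Fin l → Sid) (s : Fin n → Term Sg m) (t : Fin k → SidTerm l) (ℓ : RLabel Sg n k) :
    (ℓ.subst s t).eval E ρ ρs =
      ℓ.eval E (fun i => (s i).eval E ρ) (fun i => (t i).eval ρs) := by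
  cases ℓ with
  | honest a Ms is =>
    simp only [RLabel.subst, RLabel.eval, List.map_map]
    rw [Pat.nm_congr (by simp) (qs := fun i => (Ms.get i).eval E (fun i => (s i).eval E ρ))]
    · congr 1
      exact List.map_congr_left fun j _ => SidTerm.eval_subst t ρs j
    · intro i
      simp [Term.eval_tsubst]
  | adv a is =>
    simp only [RLabel.subst, RLabel.eval, List.map_map]
    congr 1
    funext _
    congr 1
    exact List.map_congr_left fun j _ => SidTerm.eval_subst t ρs j

theorem RLabel.eval_psubst {n k : ℕ} (E : Name → Pat Sg) (ρ : Fin n → Pat Sg) (ρs : Fin k → Sid)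
    (σ : Subst Sg) (hE : ∀ a, (E a).subst σ = E a) (ℓ : RLabel Sg n k) :
    (ℓ.eval E ρ ρs).subst σ =
      ℓ.eval E (fun i => (ρ i).subst σ) (fun i => (ρs i).subst σ.s) := by
  cases ℓ with
  | honest a Ms is =>
    simp only [RLabel.eval, Pat.subst, Term.eval_psubst E ρ σ hE, List.map_map]
    congr 1
    exact List.map_congr_left fun j _ => SidTerm.eval_psubst ρs σ.s j
  | adv a is =>
    simp only [RLabel.eval, Pat.subst, List.map_map, List.map_nil]
    congr 1
    funext _
    congr 1
    · funext i
      exact i.elim0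
    · exact List.map_congr_left fun j _ => SidTerm.eval_psubst ρs σ.s j

theorem RLabel.eval_congr {n k : ℕ} {E E' : Name → Pat Sg} (ρ : Fin n → Pat Sg)
    (ρs : Fin k → Sid) (ℓ : RLabel Sg n k) (h : ∀ a ∈ ℓ.names, E a = E' a) :
    ℓ.eval E ρ ρs = ℓ.eval E' ρ ρs := by
  cases ℓ with
  | honest a Ms is =>
    simp only [RLabel.eval]
    congr 1
    funext i
    exact Term.eval_congr ρ _ fun b hb => h b ⟨_, List.get_mem Ms i, hb⟩
  | adv a is => rfl

theorem RLabel.names_subst {n m k l : ℕ} (s : Fin n → Term Sg m) (t : Fin k → SidTerm l)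
    (ℓ : RLabel Sg n k) (a : Name) (h : a ∈ (ℓ.subst s t).names) :
    a ∈ ℓ.names ∨ ∃ i, a ∈ (s i).names := by
  cases ℓ with
  | honest b Ms is =>
    obtain ⟨M, hM, ha⟩ := h
    obtain ⟨M', hM', rfl⟩ := List.mem_map.1 hM
    exact (Term.names_subst s M' a ha).imp_left fun h => ⟨M', hM', h⟩
  | adv b is => exact absurd h id

theorem Term.exists_names_lift {n m : ℕ} {s : Fin n → Term Sg m} {a : Name}
    (h : ∃ i, a ∈ (Term.lift s i).names) : ∃ i, a ∈ (s i).names := by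
  obtain ⟨i, hi⟩ := h
  induction i using Fin.cases with
  | zero => exact absurd hi id
  | succ i =>
    rcases Term.names_subst _ _ a hi with h | ⟨j, hj⟩
    · exact ⟨i, h⟩
    · exact absurd hj id

theorem IProc.fn_subst {n m k l : ℕ} (s : Fin n → Term Sg m) (t : Fin k → SidTerm l)
    (P : IProc Sg n k) (a : Name) (h : a ∈ (P.subst s t).fn) :
    a ∈ P.fn ∨ ∃ i, a ∈ (s i).names := by
  induction P generalizing m l with
  | out M N P ih =>
    rcases h with (h | h) | h
    · exact (Term.names_subst s M a h).imp_left fun h => Or.inl (Or.inl h)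
    · exact (Term.names_subst s N a h).imp_left fun h => Or.inl (Or.inr h)
    · exact (ih s t h).imp_left Or.inr
  | inp M P ih =>
    rcases h with h | h
    · exact (Term.names_subst s M a h).imp_left Or.inl
    · exact (ih _ t h).imp Or.inr Term.exists_names_lift
  | nil => exact absurd h id
  | par P Q ihP ihQ =>
    rcases h with h | h
    · exact (ihP s t h).imp_left Or.inl
    · exact (ihQ s t h).imp_left Or.inr
  | repl P ih => exact ih s _ h
  | res ℓ P ih =>
    rcases h with h | h
    · exact (RLabel.names_subst s t ℓ a h).imp_left Or.inl
    · exact (ih _ t h).imp Or.inr Term.exists_names_lift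
  | letd g Ms P Q ihP ihQ =>
    rcases h with (h | h) | h
    · obtain ⟨i, hi⟩ := Set.mem_iUnion.1 h
      exact (Term.names_subst s _ a hi).imp_left fun h => Or.inl (Or.inl (Set.mem_iUnion.2 ⟨i, h⟩))
    · exact (ihP _ t h).imp (fun h => Or.inl (Or.inr h)) Term.exists_names_lift
    · exact (ihQ s t h).imp_left Or.inr
  | cond M N P Q ihP ihQ =>
    rcases h with ((h | h) | h) | h
    · exact (Term.names_subst s M a h).imp_left fun h => Or.inl (Or.inl (Or.inl h))
    · exact (Term.names_subst s N a h).imp_left fun h => Or.inl (Or.inl (Or.inr h))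
    · exact (ihP s t h).imp_left fun h => Or.inl (Or.inr h)
    · exact (ihQ s t h).imp_left Or.inr
  | event M P ih =>
    rcases h with h | h
    · exact (Term.names_subst s M a h).imp_left Or.inl
    · exact (ih s t h).imp_left Or.inr

/-! ### Derivable facts and well-typed processes -/

/-- The facts derivable from the clauses `𝓡` and the facts `m-event(p)` for `p ∈ Me`. -/
inductive Der (𝓡 : Set (Clause Sg)) (Me : Set (Pat Sg)) : PFact Sg → Prop
  | mevent (p : Pat Sg) (hp : p ∈ Me) : Der 𝓡 Me (.mevent p)
  | clause (R : Clause Sg) (hR : R ∈ 𝓡) (σ : Subst Sg)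
      (h : ∀ F ∈ R.hyps, Der 𝓡 Me (F.subst σ)) : Der 𝓡 Me (R.concl.subst σ)

/-- The set `D` contains all facts that describe the possible executions of the process. -/
def Typed (D : PFact Sg → Prop) (E : Name → Pat Sg) :
    {n k : ℕ} → IProc Sg n k → TEnv Sg n k → Prop
  | _, _, .out M N P, ρ => D (.message (M.eval E ρ.o) (N.eval E ρ.o)) ∧ Typed D E P ρ
  | _, _, .inp M P, ρ => ∀ p, D (.message (M.eval E ρ.o) p) → Typed D E P (ρ.cons p)
  | _, _, .nil, _ => True
  | _, _, .par P Q, ρ => Typed D E P ρ ∧ Typed D E Q ρ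
  | _, _, .repl P, ρ => ∀ l, Typed D E P (ρ.consSid (.const l))
  | _, _, .res ℓ P, ρ => Typed D E P (ρ.cons (ℓ.eval E ρ.o ρ.s))
  | _, _, .letd g Ms P Q, ρ =>
      (∀ r ∈ Sg.rules g, ∀ τ : ℕ → Pat Sg, (∀ i, (Ms i).eval E ρ.o = (r.lhs i).toPat τ) →
        Typed D E P (ρ.cons (r.rhs.toPat τ))) ∧ Typed D E Q ρ
  | _, _, .cond M N P Q, ρ => (M.eval E ρ.o = N.eval E ρ.o → Typed D E P ρ) ∧ Typed D E Q ρ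
  | _, _, .event M P, ρ =>
      D (.event (M.eval E ρ.o)) ∧ (D (.mevent (M.eval E ρ.o)) → Typed D E P ρ)

/-- The composition of a substitution of terms with an environment. -/
def TEnv.precomp {n m k l : ℕ} (E : Name → Pat Sg) (s : Fin n → Term Sg m)
    (t : Fin k → SidTerm l) (ρ : TEnv Sg m l) : TEnv Sg n k :=
  ⟨fun i => (s i).eval E ρ.o, fun i => (t i).eval ρ.s⟩

theorem TEnv.precomp_lift {n m k l : ℕ} (E : Name → Pat Sg) (s : Fin n → Term Sg m)
    (t : Fin k → SidTerm l) (ρ : TEnv Sg m l) (p : Pat Sg) :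
    TEnv.precomp E (Term.lift s) t (ρ.cons p) = (TEnv.precomp E s t ρ).cons p := by
  simp only [TEnv.precomp, TEnv.cons, TEnv.mk.injEq, and_true]
  funext i
  induction i using Fin.cases with
  | zero => rfl
  | succ i => exact Term.eval_tsubst _ _ _ _

theorem TEnv.precomp_liftSid {n m k l : ℕ} (E : Name → Pat Sg) (s : Fin n → Term Sg m)
    (t : Fin k → SidTerm l) (ρ : TEnv Sg m l) (j : Sid) :
    TEnv.precomp E s (SidTerm.lift t) (ρ.consSid j) = (TEnv.precomp E s t ρ).consSid j := by
  simp only [TEnv.precomp, TEnv.consSid, TEnv.mk.injEq, true_and]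
  funext i
  induction i using Fin.cases with
  | zero => rfl
  | succ i => exact SidTerm.eval_subst _ _ _

/-- Typing sees a term only through its pattern, so substituting terms for bound identifiers amounts
to composing the environment with the substitution. -/
theorem typed_subst (D : PFact Sg → Prop) (E : Name → Pat Sg) {n m k l : ℕ}
    (s : Fin n → Term Sg m) (t : Fin k → SidTerm l) (P : IProc Sg n k) (ρ : TEnv Sg m l)
    (h : Typed D E P (TEnv.precomp E s t ρ)) : Typed D E (P.subst s t) ρ := by
  have he : ∀ M : Term Sg n, (M.subst s).eval E ρ.o = M.eval E (TEnv.precomp E s t ρ).o :=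
    fun M => Term.eval_tsubst E ρ.o s M
  induction P generalizing m l with
  | out M N P ih =>
    simp only [IProc.subst, Typed, he] at h ⊢
    exact ⟨h.1, ih s t ρ h.2 he⟩
  | inp M P ih =>
    simp only [IProc.subst, Typed, he] at h ⊢
    intro p hp
    exact ih _ _ _ (by rw [TEnv.precomp_lift]; exact h p hp) (fun M => Term.eval_tsubst E _ _ M)
  | nil => trivial
  | par P Q ihP ihQ => exact ⟨ihP s t ρ h.1 he, ihQ s t ρ h.2 he⟩
  | repl P ih =>
    intro j
    exact ih _ _ _ (by rw [TEnv.precomp_liftSid]; exact h j) (fun M => Term.eval_tsubst E _ _ M)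
  | res ℓ P ih =>
    simp only [IProc.subst, Typed, RLabel.eval_tsubst] at h ⊢
    exact ih _ _ _ (by rw [TEnv.precomp_lift]; exact h) (fun M => Term.eval_tsubst E _ _ M)
  | letd g Ms P Q ihP ihQ =>
    simp only [IProc.subst, Typed, he] at h ⊢
    refine ⟨fun r hr τ hτ => ?_, ihQ s t ρ h.2 he⟩
    exact ihP _ _ _ (by rw [TEnv.precomp_lift]; exact h.1 r hr τ hτ)
      (fun M => Term.eval_tsubst E _ _ M)
  | cond M N P Q ihP ihQ =>
    simp only [IProc.subst, Typed, he] at h ⊢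
    exact ⟨fun e => ihP s t ρ (h.1 e) he, ihQ s t ρ h.2 he⟩
  | event M P ih =>
    simp only [IProc.subst, Typed, he] at h ⊢
    exact ⟨h.1, fun e => ih s t ρ (h.2 e) he⟩

/-- Lets the environment be extended by a fresh name without retyping the processes already present.
-/
theorem typed_congr (D : PFact Sg → Prop) {E E' : Name → Pat Sg} {n k : ℕ} (P : IProc Sg n k)
    (ρ : TEnv Sg n k) (hE : ∀ a ∈ P.fn, E a = E' a) (h : Typed D E P ρ) : Typed D E' P ρ := by
  induction P with
  | out M N P ih =>
    simp only [IProc.fn, Set.mem_union] at hE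
    simp only [Typed] at h ⊢
    rw [← Term.eval_congr ρ.o M fun a ha => hE a (by tauto),
      ← Term.eval_congr ρ.o N fun a ha => hE a (by tauto)]
    exact ⟨h.1, ih ρ (fun a ha => hE a (by tauto)) h.2⟩
  | inp M P ih =>
    simp only [IProc.fn, Set.mem_union] at hE
    simp only [Typed] at h ⊢
    rw [← Term.eval_congr ρ.o M fun a ha => hE a (by tauto)]
    exact fun p hp => ih _ (fun a ha => hE a (by tauto)) (h p hp)
  | nil => trivial
  | par P Q ihP ihQ =>
    exact ⟨ihP ρ (fun a ha => hE a (Or.inl ha)) h.1, ihQ ρ (fun a ha => hE a (Or.inr ha)) h.2⟩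
  | repl P ih => exact fun j => ih _ hE (h j)
  | res ℓ P ih =>
    simp only [IProc.fn, Set.mem_union] at hE
    simp only [Typed] at h ⊢
    rw [← RLabel.eval_congr ρ.o ρ.s ℓ fun a ha => hE a (by tauto)]
    exact ih _ (fun a ha => hE a (by tauto)) h
  | letd g Ms P Q ihP ihQ =>
    simp only [IProc.fn, Set.mem_union, Set.mem_iUnion] at hE
    simp only [Typed] at h ⊢
    refine ⟨fun r hr τ hτ => ihP _ (fun a ha => hE a (by tauto)) (h.1 r hr τ fun i => ?_),
      ihQ ρ (fun a ha => hE a (by tauto)) h.2⟩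
    rw [← hτ i]
    exact Term.eval_congr ρ.o _ fun a ha => hE a (Or.inl (Or.inl ⟨i, ha⟩))
  | cond M N P Q ihP ihQ =>
    simp only [IProc.fn, Set.mem_union] at hE
    simp only [Typed] at h ⊢
    rw [← Term.eval_congr ρ.o M fun a ha => hE a (by tauto),
      ← Term.eval_congr ρ.o N fun a ha => hE a (by tauto)]
    exact ⟨fun e => ihP ρ (fun a ha => hE a (by tauto)) (h.1 e),
      ihQ ρ (fun a ha => hE a (by tauto)) h.2⟩
  | event M P ih =>
    simp only [IProc.fn, Set.mem_union] at hE
    simp only [Typed] at h ⊢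
    rw [← Term.eval_congr ρ.o M fun a ha => hE a (by tauto)]
    exact ⟨h.1, fun e => ih ρ (fun a ha => hE a (by tauto)) (h.2 e)⟩

end

section
variable {Sg : Signature.{u, v}}

/-! ### Soundness of the clauses -/

theorem TEnv.term_subst {n k : ℕ} (ρ : TEnv Sg n k) (σ : Subst Sg) (M : Term Sg n) :
    M.eval (Pat.free Sg) (ρ.subst σ).o = (ρ.term M).subst σ :=
  (Term.eval_psubst _ _ _ (Pat.free_subst σ) M).symm

theorem TEnv.cons_subst {n k : ℕ} (ρ : TEnv Sg n k) (σ : Subst Sg) (p : Pat Sg) :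
    (ρ.cons p).subst σ = (ρ.subst σ).cons (p.subst σ) := by
  simp only [TEnv.cons, TEnv.subst, TEnv.mk.injEq, and_true]
  funext i
  induction i using Fin.cases <;> rfl

theorem TEnv.consSid_subst {n k : ℕ} (ρ : TEnv Sg n k) (σ : Subst Sg) (j : Sid) :
    (ρ.consSid j).subst σ = (ρ.subst σ).consSid (j.subst σ.s) := by
  simp only [TEnv.consSid, TEnv.subst, TEnv.mk.injEq, true_and]
  funext i
  induction i using Fin.cases <;> rfl

theorem TEnv.subst_congr {n k : ℕ} (ρ : TEnv Sg n k) {σ τ : Subst Sg}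
    (ho : ∀ x ∈ ρ.ovars, σ.o x = τ.o x) (hs : ∀ x ∈ ρ.svars, σ.s x = τ.s x) :
    ρ.subst σ = ρ.subst τ := by
  simp only [TEnv.subst, TEnv.mk.injEq]
  constructor
  · funext i
    exact Pat.subst_congr _ (fun x hx => ho x (Set.mem_iUnion.2 ⟨i, hx⟩))
      (fun x hx => hs x (Or.inl (Set.mem_iUnion.2 ⟨i, hx⟩)))
  · funext i
    exact Sid.subst_congr _ (fun x hx => hs x (Or.inr (Set.mem_iUnion.2 ⟨i, hx⟩)))

theorem TEnv.subst_comp {n k : ℕ} (ρ : TEnv Sg n k) (θ σ : Subst Sg) :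
    ρ.subst (θ.comp σ) = (ρ.subst σ).subst θ := by
  simp only [TEnv.subst, TEnv.mk.injEq, Pat.subst_comp, Sid.subst_subst, true_and]
  rfl

theorem PFact.subst_congr_hyps {H : Multiset (PFact Sg)} {σ τ : Subst Sg}
    (ho : ∀ x ∈ hypsOvars H, σ.o x = τ.o x) (hs : ∀ x ∈ hypsSvars H, σ.s x = τ.s x) :
    ∀ F ∈ H, F.subst σ = F.subst τ := fun F hF =>
  F.subst_congr (fun x hx => ho x ⟨F, hF, hx⟩) (fun x hx => hs x ⟨F, hF, hx⟩)

/-- The set `D` is closed under the clauses of `𝒮`. -/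
def ClosedUnder (D : PFact Sg → Prop) (𝒮 : Set (Clause Sg)) : Prop :=
  ∀ R ∈ 𝒮, ∀ σ : Subst Sg, (∀ F ∈ R.hyps, D (F.subst σ)) → D (R.concl.subst σ)

theorem ClosedUnder.mono {D : PFact Sg → Prop} {𝒮 𝒮' : Set (Clause Sg)} (h : ClosedUnder D 𝒮)
    (hs : 𝒮' ⊆ 𝒮) : ClosedUnder D 𝒮' := fun R hR => h R (hs hR)

/-- The translation is a symbolic run of the process: a concrete choice of inputs, sessions and
rewrite rules is an instance of the symbolic one, by freshness of the new variables and generality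
of the unifiers. The instance σ must make the accumulated hypotheses true. -/
theorem IsTransl.typed {D : PFact Sg → Prop} {n k : ℕ} (P : IProc Sg n k) {ρ : TEnv Sg n k}
    {H : Multiset (PFact Sg)} {𝒮 : Set (Clause Sg)} (hT : IsTransl P ρ H 𝒮)
    (hD : ClosedUnder D 𝒮) (σ : Subst Sg) (hσ : ∀ F ∈ H, D (F.subst σ)) :
    Typed D (Pat.free Sg) P (ρ.subst σ) := by
  induction P generalizing H 𝒮 σ with
  | out M N P ih =>
    obtain ⟨𝒮₁, h1, rfl⟩ := hT
    simp only [Typed, TEnv.term_subst]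
    exact ⟨hD _ (Or.inr rfl) σ hσ, ih h1 (hD.mono Set.subset_union_left) σ hσ⟩
  | inp M P ih =>
    obtain ⟨x, hx, h1⟩ := hT
    intro p hp
    rw [TEnv.term_subst] at hp
    simp only [Set.mem_union, not_or] at hx
    -- As x is fresh, sending it to the received pattern p changes neither ρ nor H, and turns the
    -- added hypothesis into the message fact at hand.
    let σ' : Subst Sg := ⟨Function.update σ.o x p, σ.s⟩
    have e : ∀ y, y ≠ x → σ'.o y = σ.o y := fun y hy => Function.update_of_ne hy _ _
    have hρ : ρ.subst σ' = ρ.subst σ :=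
      ρ.subst_congr (fun y hy => e y fun h => hx.1 (h ▸ hy)) (fun _ _ => rfl)
    have hH := PFact.subst_congr_hyps (H := H) (σ := σ') (τ := σ)
      (fun y hy => e y fun h => hx.2 (h ▸ hy)) (fun _ _ => rfl)
    have hxp : (Pat.var x : Pat Sg).subst σ' = p := Function.update_self _ _ _
    have key := ih h1 hD σ' (by
      intro F hF
      rcases Multiset.mem_add.1 hF with hF | hF
      · rw [hH F hF]
        exact hσ F hF
      · rw [Multiset.mem_singleton.1 hF]
        simp only [PFact.subst, hxp]
        rw [← TEnv.term_subst, hρ, TEnv.term_subst]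
        exact hp)
    rw [TEnv.cons_subst, hρ, hxp] at key
    exact key
  | nil => trivial
  | par P Q ihP ihQ =>
    obtain ⟨𝒮₁, 𝒮₂, h1, h2, rfl⟩ := hT
    exact ⟨ihP h1 (hD.mono Set.subset_union_left) σ hσ,
      ihQ h2 (hD.mono Set.subset_union_right) σ hσ⟩
  | repl P ih =>
    obtain ⟨i, hi, h1⟩ := hT
    intro l
    simp only [Set.mem_union, not_or] at hi
    let σ' : Subst Sg := ⟨σ.o, Function.update σ.s i (.const l)⟩
    have e : ∀ y, y ≠ i → σ'.s y = σ.s y := fun y hy => Function.update_of_ne hy _ _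
    have hρ : ρ.subst σ' = ρ.subst σ :=
      ρ.subst_congr (fun _ _ => rfl) (fun y hy => e y fun h => hi.1 (h ▸ hy))
    have hH := PFact.subst_congr_hyps (H := H) (σ := σ') (τ := σ)
      (fun _ _ => rfl) (fun y hy => e y fun h => hi.2 (h ▸ hy))
    have hip : (Sid.var i).subst σ'.s = .const l := Function.update_self _ _ _
    have key := ih h1 hD σ' (fun F hF => by rw [hH F hF]; exact hσ F hF)
    rw [TEnv.consSid_subst, hρ, hip] at key
    exact key
  | res ℓ P ih =>
    have key := ih hT hD σ hσ
    rw [TEnv.cons_subst, RLabel.eval_psubst _ _ _ _ (Pat.free_subst σ)] at key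
    exact key
  | letd g Ms P Q ihP ihQ =>
    obtain ⟨𝒮₁, 𝒮₂, h1, h2, rfl⟩ := hT
    refine ⟨fun r hr τ hτ => ?_, ihQ h2 (hD.mono Set.subset_union_right) σ hσ⟩
    simp only [TEnv.term_subst] at hτ
    rcases h1 r hr with ⟨μ, μ', hmg, hP⟩ | ⟨hno, _⟩
    -- The concrete rule application unifies, hence factors through the most general pair, but only
    -- on the variables of ρ, H and the left-hand sides of the rule.
    · obtain ⟨θ, ho, hs, hv⟩ := hmg.2 σ τ hτ
      have hH := PFact.subst_congr_hyps (H := H) (σ := σ) (τ := θ.comp μ)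
        (fun x hx => ho x (Or.inr hx)) (fun x hx => hs x (Or.inr hx))
      have hρ : ρ.subst σ = ρ.subst (θ.comp μ) :=
        ρ.subst_congr (fun x hx => ho x (Or.inl hx)) (fun x hx => hs x (Or.inl hx))
      have key := ihP hP (hD.mono (Set.subset_union_of_subset_left
        (Set.subset_biUnion_of_mem (u := fun r => 𝒮₁ r) hr) _)) θ (by
          intro F hF
          obtain ⟨F', hF', rfl⟩ := Multiset.mem_map.1 hF
          rw [← PFact.subst_comp, ← hH F' hF']
          exact hσ F' hF')
      rw [TEnv.cons_subst, ← TEnv.subst_comp, ← hρ, RTerm.toPat_subst] at key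
      -- Agreement on the left-hand sides suffices because the right-hand side has no other
      -- variables.
      have hr' : r.rhs.toPat (fun x => (μ' x).subst θ) = r.rhs.toPat τ := by
        refine RTerm.toPat_congr _ fun x hx => ?_
        obtain ⟨i, hi⟩ := Set.mem_iUnion.1 (r.rhs_vars hx)
        exact (hv i x hi).symm
      rw [hr'] at key
      exact key
    · exact absurd ⟨σ, τ, hτ⟩ hno
  | cond M N P Q ihP ihQ =>
    obtain ⟨𝒮₁, 𝒮₂, h1, h2, rfl⟩ := hT
    refine ⟨fun e => ?_, ihQ h2 (hD.mono Set.subset_union_right) σ hσ⟩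
    simp only [TEnv.term_subst] at e
    rcases h1 with ⟨μ, hmg, hP⟩ | ⟨hno, _⟩
    · obtain ⟨θ, rfl⟩ := hmg.2 σ e
      have key := ihP hP (hD.mono Set.subset_union_left) θ (by
          intro F hF
          obtain ⟨F', hF', rfl⟩ := Multiset.mem_map.1 hF
          rw [← PFact.subst_comp]
          exact hσ F' hF')
      rw [← TEnv.subst_comp] at key
      exact key
    · exact absurd ⟨σ, e⟩ hno
  | event M P ih =>
    obtain ⟨𝒮₁, h1, rfl⟩ := hT
    simp only [Typed, TEnv.term_subst]
    refine ⟨hD _ (Or.inr rfl) σ hσ, fun hm => ih h1 (hD.mono Set.subset_union_left) σ ?_⟩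
    intro F hF
    rcases Multiset.mem_add.1 hF with hF | hF
    · exact hσ F hF
    · rw [Multiset.mem_singleton.1 hF]
      exact hm

/-! ### The adversary -/

theorem instrAdvAux_fn {n : ℕ} (P : Proc Sg n) (k : ℕ) (s : List (Fin k)) :
    (P.instrAdvAux k s).fn = P.fn := by
  induction P generalizing k with
  | res a P ih => simp [Proc.instrAdvAux, IProc.fn, Proc.fn, RLabel.names, ih]
  | _ => simp_all [Proc.instrAdvAux, IProc.fn, Proc.fn]

theorem mem_clauseRf_hyps {f : Sg.Con} {x : Fin (Sg.conArity f) → ℕ} {F : PFact Sg} :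
    F ∈ (clauseRf f x).hyps ↔ ∃ i, F = .attacker (.var (x i)) := by
  simp [clauseRf, eq_comm]

theorem mem_clauseRg_hyps {d : ℕ} {r : Rule Sg.Con Sg.conArity d} {F : PFact Sg} :
    F ∈ (clauseRg r).hyps ↔ ∃ i, F = .attacker ((r.lhs i).toPat Pat.var) := by
  simp [clauseRg, eq_comm]

/-- The attacker builds any public term from known parts: (Rf) handles each constructor. -/
theorem attacker_term {D : PFact Sg → Prop} {Init : Finset Name}
    (hD : ClosedUnder D {R | AttackerClause Init R}) {n : ℕ} {E : Name → Pat Sg}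
    {ρ : Fin n → Pat Sg} (hE : ∀ a ∈ Init, D (.attacker (E a))) (hρ : ∀ i, D (.attacker (ρ i)))
    (M : Term Sg n) (hn : M.names ⊆ (Init : Set Name)) (hp : M.PublicOnly) :
    D (.attacker (M.eval E ρ)) := by
  induction M with
  | bvar i => exact hρ i
  | name a => exact hE a (hn rfl)
  | app f ts ih =>
    have h : ∀ i, D (.attacker ((ts i).eval E ρ)) := fun i =>
      ih i (fun a ha => hn (Set.mem_iUnion.2 ⟨i, ha⟩)) (hp.2 i)
    have := hD _ (.rf f hp.1)
      ⟨fun x => if hx : x < Sg.conArity f then (ts ⟨x, hx⟩).eval E ρ else .var 0, Sid.var⟩ (by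
        intro F hF
        obtain ⟨i, rfl⟩ := mem_clauseRf_hyps.1 hF
        simpa [PFact.subst, Pat.subst] using h i)
    simpa [clauseRf, PFact.subst, Pat.subst, Term.eval] using this

/-- The invariant is that every bound identifier is known to the attacker. Outputs are then typed by
(Rs), inputs preserve the invariant by (Rl), and destructors preserve it by (Rg). -/
theorem adversary_typed {D : PFact Sg → Prop} {Init : Finset Name}
    (hD : ClosedUnder D {R | AttackerClause Init R}) {n k : ℕ} {E : Name → Pat Sg}
    (hE : ∀ a ∈ Init, D (.attacker (E a))) (P : Proc Sg n) (s : List (Fin k)) (ρ : TEnv Sg n k)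
    (hρ : ∀ i, D (.attacker (ρ.o i))) (hfn : P.fn ⊆ (Init : Set Name)) (hev : P.NoEvent)
    (hp : P.PublicOnly) : Typed D E (P.instrAdvAux k s) ρ := by
  have two : ∀ p q : Pat Sg, ∃ σ : Subst Sg, σ.o 0 = p ∧ σ.o 1 = q := fun p q =>
    ⟨⟨fun x => if x = 0 then p else q, Sid.var⟩, by simp, by simp⟩
  have hrs : ∀ p q, D (.attacker p) → D (.attacker q) → D (.message p q) := by
    intro p q h1 h2
    obtain ⟨σ, rfl, rfl⟩ := two p q
    exact hD _ .rs σ (by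
      intro F hF
      simp only [Multiset.insert_eq_cons, Multiset.mem_cons, Multiset.mem_singleton] at hF
      rcases hF with rfl | rfl
      exacts [h1, h2])
  have hrl : ∀ p q, D (.message p q) → D (.attacker p) → D (.attacker q) := by
    intro p q h1 h2
    obtain ⟨σ, rfl, rfl⟩ := two p q
    exact hD _ .rl σ (by
      intro F hF
      simp only [Multiset.insert_eq_cons, Multiset.mem_cons, Multiset.mem_singleton] at hF
      rcases hF with rfl | rfl
      exacts [h1, h2])
  have hcons : ∀ {n k : ℕ} (ρ : TEnv Sg n k) (p : Pat Sg), (∀ i, D (.attacker (ρ.o i))) →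
      D (.attacker p) → ∀ i, D (.attacker ((ρ.cons p).o i)) := by
    intro n k ρ p h1 h2 i
    induction i using Fin.cases with
    | zero => exact h2
    | succ i => exact h1 i
  induction P generalizing k with
  | out M N P ih =>
    simp only [Proc.fn, Set.union_subset_iff] at hfn
    exact ⟨hrs _ _ (attacker_term hD hE hρ M hfn.1.1 hp.1)
      (attacker_term hD hE hρ N hfn.1.2 hp.2.1), ih s ρ hρ hfn.2 hev hp.2.2⟩
  | inp M P ih =>
    simp only [Proc.fn, Set.union_subset_iff] at hfn
    exact fun p hm => ih s _ (hcons ρ p hρ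
      (hrl _ _ hm (attacker_term hD hE hρ M hfn.1 hp.1))) hfn.2 hev hp.2
  | nil => trivial
  | par P Q ihP ihQ =>
    simp only [Proc.fn, Set.union_subset_iff] at hfn
    exact ⟨ihP s ρ hρ hfn.1 hev.1 hp.1, ihQ s ρ hρ hfn.2 hev.2 hp.2⟩
  | repl P ih => exact fun l => ih _ _ hρ hfn hev hp
  | res a P ih =>
    -- An adversary label is b₀[a[s]], which is an instance of (Rn).
    refine ih s _ (hcons ρ _ hρ ?_) hfn hev hp
    exact hD _ .rn ⟨fun _ => .nm (.ofName a) 0 Fin.elim0 ((s.map SidTerm.bvar).map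
      (SidTerm.eval ρ.s)), Sid.var⟩ (fun F hF => absurd hF (Multiset.notMem_zero F))
  | letd g Ms P Q ihP ihQ =>
    simp only [Proc.fn, Set.union_subset_iff, Set.iUnion_subset_iff] at hfn
    refine ⟨fun r hr τ hτ => ihP s _ (hcons ρ _ hρ ?_) hfn.1.2 hev.1 hp.2.2.1,
      ihQ s ρ hρ hfn.2 hev.2 hp.2.2.2⟩
    have := hD _ (.rg g hp.1 r hr) ⟨τ, Sid.var⟩ (by
      intro F hF
      obtain ⟨i, rfl⟩ := mem_clauseRg_hyps.1 hF
      simp only [PFact.subst, RTerm.toPat_subst]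
      exact hτ i ▸ attacker_term hD hE hρ (Ms i) (hfn.1.1 i) (hp.2.1 i))
    simpa only [clauseRg, PFact.subst, RTerm.toPat_subst, Pat.subst] using this
  | cond M N P Q ihP ihQ =>
    simp only [Proc.fn, Set.union_subset_iff] at hfn
    exact ⟨fun _ => ihP s ρ hρ hfn.1.2 hev.1 hp.2.2.1, ihQ s ρ hρ hfn.2 hev.2 hp.2.2.2⟩
  | event M P ih => exact absurd hev id

/-! ### Subject reduction -/

def TEnv.nil (Sg : Signature.{u, v}) : TEnv Sg 0 0 := ⟨Fin.elim0, Fin.elim0⟩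

theorem TEnv.eq_nil (ρ : TEnv Sg 0 0) : ρ = TEnv.nil Sg := by
  cases ρ
  simp only [TEnv.nil, TEnv.mk.injEq]
  exact ⟨funext fun i => i.elim0, funext fun i => i.elim0⟩

/-- The free names of the processes of the configuration are in the domain of the environment,
and the processes are well-typed. -/
def Config.Ok (D : PFact Sg → Prop) (c : Config Sg) : Prop :=
  ∀ P ∈ c.procs, P.fn ⊆ c.E.dom ∧ Typed D c.E.pat P (TEnv.nil Sg)

theorem ok_add {D : PFact Sg → Prop} {S : Set ℕ} {E : NEnv Sg} {Ps Qs : Multiset (IProc Sg 0 0)} :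
    Config.Ok D ⟨S, E, Ps + Qs⟩ ↔ Config.Ok D ⟨S, E, Ps⟩ ∧ Config.Ok D ⟨S, E, Qs⟩ := by
  simp only [Config.Ok, Multiset.mem_add]
  exact ⟨fun h => ⟨fun P hP => h P (Or.inl hP), fun P hP => h P (Or.inr hP)⟩,
    fun h P hP => hP.elim (h.1 P) (h.2 P)⟩

theorem ok_cons {D : PFact Sg → Prop} {S : Set ℕ} {E : NEnv Sg} {P : IProc Sg 0 0}
    {Qs : Multiset (IProc Sg 0 0)} :
    Config.Ok D ⟨S, E, insert P Qs⟩ ↔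
      (P.fn ⊆ E.dom ∧ Typed D E.pat P (TEnv.nil Sg)) ∧ Config.Ok D ⟨S, E, Qs⟩ := by
  simp [Config.Ok]

theorem ok_singleton {D : PFact Sg → Prop} {S : Set ℕ} {E : NEnv Sg} {P : IProc Sg 0 0} :
    Config.Ok D ⟨S, E, {P}⟩ ↔ P.fn ⊆ E.dom ∧ Typed D E.pat P (TEnv.nil Sg) := by
  simp [Config.Ok]

/-- The new name is outside the domain, which contains all free names of the processes, so no
pattern in use changes. -/
theorem ok_extend {D : PFact Sg → Prop} {S : Set ℕ} {E : NEnv Sg} {Ps : Multiset (IProc Sg 0 0)}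
    {a : Name} (ha : a ∉ E.dom) (p : Pat Sg) (h : Config.Ok D ⟨S, E, Ps⟩) :
    Config.Ok D ⟨S, E.extend a p, Ps⟩ := fun P hP =>
  ⟨(h P hP).1.trans (Set.subset_insert _ _), typed_congr D P _ (fun b hb =>
    (Function.update_of_ne (fun e : b = a => ha (e ▸ (h P hP).1 hb)) _ _).symm) (h P hP).2⟩

theorem ok_inst {D : PFact Sg → Prop} {E : NEnv Sg} {P : IProc Sg 1 0} {M : Term Sg 0}
    (hfn : P.fn ⊆ E.dom) (hM : M.names ⊆ E.dom)
    (h : Typed D E.pat P ((TEnv.nil Sg).cons (E.term M))) :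
    (P.inst M).fn ⊆ E.dom ∧ Typed D E.pat (P.inst M) (TEnv.nil Sg) := by
  constructor
  · intro a ha
    rcases IProc.fn_subst _ _ P a ha with h | ⟨_, h⟩
    exacts [hfn h, hM h]
  · refine typed_subst D _ _ _ P _ ?_
    convert h using 2
    simp only [TEnv.precomp, TEnv.cons, TEnv.mk.injEq]
    refine ⟨funext fun i => ?_, funext fun i => i.elim0⟩
    rw [Subsingleton.elim i 0]
    rfl

/-- Each rule consumes exactly what typing provides. An output types the message that the input
receives; a destructor step is an instance of a rule. Only an event needs outside help, its m-event
fact, left as the hypothesis `hme`. -/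
theorem Red.ok {D : PFact Sg → Prop} {c d : Config Sg} (hr : Red c d) (h : c.Ok D)
    (hme : ∀ S E Ps M P, c = ⟨S, E, Ps + {.event M P}⟩ → d = ⟨S, E, Ps + {P}⟩ →
      D (.mevent (E.term M))) : d.Ok D := by
  cases hr with
  | nil S E Ps => exact (ok_add.1 h).1
  | repl S E Ps P l hl =>
    obtain ⟨h1, h2⟩ := ok_add.1 h
    have h3 := ok_singleton.1 h2
    refine ok_add.2 ⟨h1, ok_cons.2 ⟨⟨?_, ?_⟩, h2⟩⟩
    · intro a ha
      rcases IProc.fn_subst _ _ P a ha with h | ⟨i, _⟩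
      exacts [h3.1 h, i.elim0]
    · refine typed_subst D _ _ _ P _ ?_
      have h4 := h3.2 l
      convert h4 using 2
      simp only [TEnv.precomp, TEnv.consSid, TEnv.mk.injEq]
      refine ⟨funext fun i => i.elim0, funext fun i => ?_⟩
      rw [Subsingleton.elim i 0]
      rfl
  | par S E Ps P Q =>
    obtain ⟨h1, h2⟩ := ok_add.1 h
    obtain ⟨h3, h4⟩ := ok_singleton.1 h2
    simp only [IProc.fn, Set.union_subset_iff] at h3
    exact ok_add.2 ⟨h1, ok_cons.2 ⟨⟨h3.1, h4.1⟩, ok_singleton.2 ⟨h3.2, h4.2⟩⟩⟩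
  | res S E Ps ℓ P a ha =>
    obtain ⟨h1, h2⟩ := ok_add.1 h
    obtain ⟨h3, h4⟩ := ok_singleton.1 h2
    simp only [IProc.fn, Set.union_subset_iff] at h3
    refine ok_add.2 ⟨ok_extend ha _ h1, ok_singleton.2 (ok_inst (h3.2.trans (Set.subset_insert _ _))
      (fun b hb => by rw [Set.mem_singleton_iff.1 hb]; exact Set.mem_insert _ _) ?_)⟩
    have e : (E.extend a (E.label ℓ)).term (.name a) = E.label ℓ := Function.update_self _ _ _
    rw [e]
    exact typed_congr D P _ (fun b hb =>
      (Function.update_of_ne (fun e : b = a => ha (e ▸ h3.2 hb)) _ _).symm) h4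
  | comm S E Ps N M Q P =>
    obtain ⟨h1, h2⟩ := ok_add.1 h
    obtain ⟨⟨h3, h4⟩, h5⟩ := ok_cons.1 h2
    obtain ⟨h6, h7⟩ := ok_singleton.1 h5
    simp only [IProc.fn, Set.union_subset_iff] at h3 h6
    exact ok_add.2 ⟨h1, ok_cons.2 ⟨⟨h3.2, h4.2⟩,
      ok_singleton.2 (ok_inst h6.2 h3.1.2 (h7 _ h4.1))⟩⟩
  | destr₁ S E Ps g Ms P Q M hM =>
    obtain ⟨h1, h2⟩ := ok_add.1 h
    obtain ⟨h3, h4⟩ := ok_singleton.1 h2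
    simp only [IProc.fn, Set.union_subset_iff, Set.iUnion_subset_iff] at h3
    refine ok_add.2 ⟨h1, ok_singleton.2 (ok_inst h3.1.2 (fun a ha => ?_) ?_)⟩
    · obtain ⟨i, hi⟩ := hM.names_subset a ha
      exact h3.1.1 i hi
    · obtain ⟨r, hr, s, hs, rfl⟩ := hM
      have := h4.1 r hr (fun x => E.term (s x)) (fun i => by rw [hs i, RTerm.toTerm_eval]; rfl)
      rw [NEnv.term, RTerm.toTerm_eval]
      exact this
  | destr₂ S E Ps g Ms P Q _ =>
    obtain ⟨h1, h2⟩ := ok_add.1 h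
    obtain ⟨h3, h4⟩ := ok_singleton.1 h2
    simp only [IProc.fn, Set.union_subset_iff] at h3
    exact ok_add.2 ⟨h1, ok_singleton.2 ⟨h3.2, h4.2⟩⟩
  | cond₁ S E Ps M P Q =>
    obtain ⟨h1, h2⟩ := ok_add.1 h
    obtain ⟨h3, h4⟩ := ok_singleton.1 h2
    simp only [IProc.fn, Set.union_subset_iff] at h3
    exact ok_add.2 ⟨h1, ok_singleton.2 ⟨h3.1.2, h4.1 rfl⟩⟩
  | cond₂ S E Ps M N P Q _ =>
    obtain ⟨h1, h2⟩ := ok_add.1 h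
    obtain ⟨h3, h4⟩ := ok_singleton.1 h2
    simp only [IProc.fn, Set.union_subset_iff] at h3
    exact ok_add.2 ⟨h1, ok_singleton.2 ⟨h3.2, h4.2⟩⟩
  | event S E Ps M P =>
    obtain ⟨h1, h2⟩ := ok_add.1 h
    obtain ⟨h3, h4⟩ := ok_singleton.1 h2
    simp only [IProc.fn, Set.union_subset_iff] at h3
    exact ok_add.2 ⟨h1, ok_singleton.2 ⟨h3.2, h4.2 (hme S E Ps M P rfl rfl)⟩⟩

/-! ### Environments along a trace -/

theorem Red.env {c d : Config Sg} (hr : Red c d) :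
    c.E.dom ⊆ d.E.dom ∧ ∀ a ∈ c.E.dom, d.E.pat a = c.E.pat a := by
  cases hr with
  | res S E Ps ℓ P a ha =>
    exact ⟨Set.subset_insert _ _, fun b hb => Function.update_of_ne (fun e : b = a => ha (e ▸ hb)) _ _⟩
  | _ => exact ⟨subset_rfl, fun _ _ => rfl⟩

theorem Trace.env (T : Trace Sg) {i j : ℕ} (hij : i ≤ j) (hj : j ≤ T.len) :
    (T.cfg i).E.dom ⊆ (T.cfg j).E.dom ∧
      ∀ a ∈ (T.cfg i).E.dom, (T.cfg j).E.pat a = (T.cfg i).E.pat a := by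
  induction j, hij using Nat.le_induction with
  | base => exact ⟨subset_rfl, fun _ _ => rfl⟩
  | succ j hij ih =>
    obtain ⟨h1, h2⟩ := ih (by omega)
    obtain ⟨h3, h4⟩ := (T.red j (by omega)).env
    exact ⟨h1.trans h3, fun a ha => (h4 a (h1 ha)).trans (h2 a ha)⟩

/-- Satisfaction of facts refers to the last environment, typing to the current one; this reconciles
them. -/
theorem Trace.term_env (T : Trace Sg) {i : ℕ} (hi : i ≤ T.len) {M : Term Sg 0}
    (hM : M.names ⊆ (T.cfg i).E.dom) : (T.cfg T.len).E.term M = (T.cfg i).E.term M :=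
  Term.eval_congr _ _ fun a ha => (T.env hi le_rfl).2 a (hM ha)

/-- If the trace satisfies `F`, then `F` is derivable from the clauses and the facts `m-event(p)`
such that the trace satisfies `event(p)`. -/
theorem Trace.SatFact.der {Init : Finset Name} {P' : IProc Sg 0 0} {𝓡₀ : Set (Clause Sg)}
    (h𝓡 : IsClauseSet P' Init 𝓡₀) {Q : Proc Sg 0} (hQ : IsAdversary Init Q) {S₀ : Set ℕ}
    {E₀ : NEnv Sg} (hdom : P'.fn ∪ (Init : Set Name) ⊆ E₀.dom)
    (hE₀ : ∀ a ∈ E₀.dom, E₀.pat a = Pat.free Sg a) {T : Trace Sg}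
    (hT : T.cfg 0 = ⟨S₀, E₀, {P', instrAdv Q}⟩) {F : PFact Sg} (hF : T.SatFact Init F) :
    Der 𝓡₀ {p | T.SatFact Init (.event p)} F := by
  obtain ⟨𝒮, h𝒮, rfl⟩ := h𝓡
  set D := Der (𝒮 ∪ {R | AttackerClause Init R}) {p | T.SatFact Init (.event p)}
  have hD : ClosedUnder D (𝒮 ∪ {R | AttackerClause Init R}) := fun R hR σ h => .clause R hR σ h
  have hA := hD.mono Set.subset_union_right
  rw [Set.union_subset_iff] at hdom
  have hInit : ∀ a ∈ Init, D (.attacker (E₀.pat a)) := by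
    intro a ha
    rw [hE₀ a (hdom.2 ha), ← Pat.free_subst ⟨Pat.var, Sid.var⟩ a]
    exact hA _ (.init a ha) _ (fun F hF => absurd hF (Multiset.notMem_zero F))
  have h0 : (T.cfg 0).Ok D := by
    rw [hT]
    refine ok_cons.2 ⟨⟨hdom.1, ?_⟩, ok_singleton.2 ⟨?_, ?_⟩⟩
    · have := IsTransl.typed P' h𝒮 (hD.mono Set.subset_union_left) ⟨Pat.var, Sid.var⟩
        (fun F hF => absurd hF (Multiset.notMem_zero F))
      rw [TEnv.eq_nil (TEnv.subst _ _)] at this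
      exact typed_congr D P' _ (fun a ha => (hE₀ a (hdom.1 ha)).symm) this
    · rw [instrAdv, instrAdvAux_fn]
      exact hQ.fn_subset.trans hdom.2
    · exact adversary_typed hA hInit Q [] _ (fun i => i.elim0) hQ.fn_subset hQ.noEvent hQ.publicOnly
  have hok : ∀ i ≤ T.len, (T.cfg i).Ok D := by
    intro i
    induction i with
    | zero => exact fun _ => h0
    | succ i ih =>
      intro hi
      refine (T.red i hi).ok (ih (by omega)) fun S E Ps M P hc hd => .mevent _ ?_
      -- The reduction under consideration is itself the execution that makes the trace satisfy the
      -- event.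
      refine ⟨.event M, ⟨S, E, Ps, P, i, hi, hc, hd⟩, ?_⟩
      have h1 := ih (by omega)
      rw [hc] at h1
      have h2 := (ok_singleton.1 (ok_add.1 h1).2).1
      simp only [IProc.fn, Set.union_subset_iff] at h2
      have h3 := T.term_env (i := i) (by omega) (M := M) (by rw [hc]; exact h2.1)
      rw [hc] at h3
      simp only [NEnv.atom, h3]
  have hcomm : ∀ S E Ps N M Q P, T.Contains ⟨S, E, Ps + {.out N M Q, .inp N P}⟩
      ⟨S, E, Ps + {Q, P.inst M}⟩ →
      D (.message ((T.cfg T.len).E.term N) ((T.cfg T.len).E.term M)) := by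
    rintro S E Ps N M Q P ⟨i, hi, hc, _⟩
    have h1 := hok i hi.le
    rw [hc] at h1
    obtain ⟨h2, h3⟩ := (ok_cons.1 (ok_add.1 h1).2).1
    simp only [IProc.fn, Set.union_subset_iff] at h2
    rw [T.term_env (i := i) hi.le (M := M) (by rw [hc]; exact h2.1.2),
      T.term_env (i := i) hi.le (M := N) (by rw [hc]; exact h2.1.1), hc]
    exact h3.1
  obtain ⟨α, hα, rfl⟩ := hF
  cases α with
  | attacker M =>
    obtain ⟨S, E, Ps, c, Q, P, hc, hcon⟩ := hα
    have h1 := hcomm _ _ _ _ _ _ _ hcon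
    have h2 : D (.attacker ((T.cfg T.len).E.term (.name c))) := by
      have := (T.env (Nat.zero_le _) le_rfl).2 c (by rw [hT]; exact hdom.2 hc)
      rw [hT] at this
      rw [NEnv.term, Term.eval, this]
      exact hInit c hc
    -- A communication on a name of `Init` is a message on a channel known to the attacker, so (Rl)
    -- applies.
    have := hA _ .rl ⟨fun x => if x = 0 then (T.cfg T.len).E.term (.name c)
      else (T.cfg T.len).E.term M, Sid.var⟩ (by
        intro F hF
        simp only [Multiset.insert_eq_cons, Multiset.mem_cons, Multiset.mem_singleton] at hF
        rcases hF with rfl | rfl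
        · simpa [PFact.subst, Pat.subst] using h1
        · simpa [PFact.subst, Pat.subst] using h2)
    simpa [PFact.subst, Pat.subst, NEnv.atom] using this
  | message N M =>
    obtain ⟨S, E, Ps, Q, P, hcon⟩ := hα
    exact hcomm _ _ _ _ _ _ _ hcon
  | event M =>
    obtain ⟨S, E, Ps, P, i, hi, hc, _⟩ := hα
    have h1 := hok i hi.le
    rw [hc] at h1
    obtain ⟨h2, h3⟩ := ok_singleton.1 (ok_add.1 h1).2
    simp only [IProc.fn, Set.union_subset_iff] at h2
    simp only [NEnv.atom]
    rw [T.term_env (i := i) hi.le (M := M) (by rw [hc]; exact h2.1), hc]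
    exact h3.1

end

section
variable {Sg : Signature.{u, v}}

/-! ### Weights of facts -/

/-- The fact is `attacker(f(…))` for a data constructor `f`. -/
def PFact.IsComposed (F : PFact Sg) : Prop :=
  ∃ f ps, Sg.IsData f ∧ F = .attacker (.app f ps)

/-- `A` is obtained from `F` by exhaustive decomposition of data constructors, in `d` steps. -/
inductive Leaf : PFact Sg → ℕ → PFact Sg → Prop
  | self (F : PFact Sg) (h : ¬ F.IsComposed) : Leaf F 0 F
  | arg (f : Sg.Con) (hf : Sg.IsData f) (ps : Fin (Sg.conArity f) → Pat Sg)
      (i : Fin (Sg.conArity f)) (d : ℕ) (A : PFact Sg) (h : Leaf (.attacker (ps i)) d A) :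
      Leaf (.attacker (.app f ps)) (d + 1) A

open Classical in
/-- The sum of the weights of the components of `attacker(p)` and of the number of decomposed
data constructors. -/
noncomputable def Pat.wt (w : PFact Sg → ℕ) : Pat Sg → ℕ
  | .var x => w (.attacker (.var x))
  | .nm a n ps is => w (.attacker (.nm a n ps is))
  | .app f ps => if Sg.IsData f then 1 + ∑ i, (ps i).wt w else w (.attacker (.app f ps))

noncomputable def PFact.wt (w : PFact Sg → ℕ) : PFact Sg → ℕ
  | .attacker p => p.wt w
  | F => w F

theorem PFact.wt_of_not_isComposed (w : PFact Sg → ℕ) {F : PFact Sg} (h : ¬ F.IsComposed) :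
    F.wt w = w F := by
  rcases F with p | _ | _ | _
  · rcases p with x | ⟨a, n, ps, is⟩ | ⟨f, ps⟩
    · rfl
    · rfl
    · have hf : ¬ Sg.IsData f := fun hf => h ⟨f, ps, hf, rfl⟩
      simp only [PFact.wt, Pat.wt, if_neg hf]
  all_goals rfl

theorem PFact.wt_app (w : PFact Sg → ℕ) {f : Sg.Con} (hf : Sg.IsData f)
    (ps : Fin (Sg.conArity f) → Pat Sg) :
    (PFact.attacker (.app f ps)).wt w = 1 + ∑ i, (PFact.attacker (ps i)).wt w := by
  simp only [PFact.wt, Pat.wt, if_pos hf]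

theorem Leaf.not_isComposed {F A : PFact Sg} {d : ℕ} (h : Leaf F d A) : ¬ A.IsComposed := by
  induction h with
  | self F h => exact h
  | arg _ _ _ _ _ _ _ ih => exact ih

theorem Leaf.of_app {f : Sg.Con} (hf : Sg.IsData f) {ps : Fin (Sg.conArity f) → Pat Sg} {d : ℕ}
    {A : PFact Sg} (h : Leaf (.attacker (.app f ps)) d A) :
    ∃ i d', d = d' + 1 ∧ Leaf (.attacker (ps i)) d' A := by
  cases h with
  | self _ h => exact absurd ⟨f, ps, hf, rfl⟩ h
  | arg _ _ _ i d _ h => exact ⟨i, d, rfl, h⟩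

theorem Leaf.eq_of_not_isComposed {F A : PFact Sg} {d : ℕ} (hF : ¬ F.IsComposed)
    (h : Leaf F d A) : d = 0 ∧ A = F := by
  cases h with
  | self _ _ => exact ⟨rfl, rfl⟩
  | arg f hf ps _ _ _ _ => exact absurd ⟨f, ps, hf, rfl⟩ hF

theorem Leaf.wt_le (w : PFact Sg → ℕ) {F A : PFact Sg} {d : ℕ} (h : Leaf F d A) :
    w A ≤ F.wt w := by
  induction h with
  | self F h => exact (F.wt_of_not_isComposed w h).ge
  | arg f hf ps i d A h ih =>
    rw [PFact.wt_app w hf]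
    have := Finset.single_le_sum (f := fun i => (PFact.attacker (ps i)).wt w)
      (fun _ _ => Nat.zero_le _) (Finset.mem_univ i)
    exact ih.trans (this.trans (Nat.le_add_left _ _))

/-- The weight is a sum over components plus a number of constructors that does not depend on the
weight function. -/
theorem PFact.wt_mono {w w' : PFact Sg → ℕ} (F : PFact Sg)
    (h : ∀ d A, Leaf F d A → w A ≤ w' A) : F.wt w ≤ F.wt w' := by
  have key : ∀ p : Pat Sg, (∀ d A, Leaf (.attacker p) d A → w A ≤ w' A) → p.wt w ≤ p.wt w' := by
    intro p
    induction p with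
    | var x => exact fun h => h 0 _ (.self _ (by rintro ⟨_, _, _, h⟩; cases h))
    | nm a n ps is _ => exact fun h => h 0 _ (.self _ (by rintro ⟨_, _, _, h⟩; cases h))
    | app f ps ih =>
      intro h
      by_cases hf : Sg.IsData f
      · simp only [Pat.wt, if_pos hf]
        exact Nat.add_le_add_left (Finset.sum_le_sum fun i _ =>
          ih i fun d A hA => h _ A (.arg f hf ps i d A hA)) _
      · simp only [Pat.wt, if_neg hf]
        exact h 0 _ (.self _ (by rintro ⟨_, _, hf', h⟩; cases h; exact hf hf'))
  cases F with
  | attacker p => exact key p h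
  | _ => exact h 0 _ (.self _ (by rintro ⟨_, _, _, h⟩; cases h))

/-- All components of `F` are in `Dv`. -/
def Drv (Dv : Set (PFact Sg)) (F : PFact Sg) : Prop := ∀ d A, Leaf F d A → A ∈ Dv

noncomputable def hypsWt (w : PFact Sg → ℕ) (σ : Subst Sg) (H : Multiset (PFact Sg)) : ℕ :=
  (H.map fun F => (F.subst σ).wt w).sum

theorem hypsWt_add (w : PFact Sg → ℕ) (σ : Subst Sg) (H H' : Multiset (PFact Sg)) :
    hypsWt w σ (H + H') = hypsWt w σ H + hypsWt w σ H' := by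
  simp [hypsWt]

theorem hypsWt_cons (w : PFact Sg → ℕ) (σ : Subst Sg) (F : PFact Sg) (H : Multiset (PFact Sg)) :
    hypsWt w σ (F ::ₘ H) = (F.subst σ).wt w + hypsWt w σ H := by
  simp [hypsWt]

theorem hypsWt_mono (w : PFact Sg → ℕ) (σ : Subst Sg) {H H' : Multiset (PFact Sg)} (h : H ≤ H') :
    hypsWt w σ H ≤ hypsWt w σ H' := by
  obtain ⟨K, rfl⟩ := Multiset.le_iff_exists_add.1 h
  rw [hypsWt_add]
  omega

theorem wt_le_hypsWt (w : PFact Sg → ℕ) (σ : Subst Sg) {F : PFact Sg} {H : Multiset (PFact Sg)}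
    (h : F ∈ H) : (F.subst σ).wt w ≤ hypsWt w σ H := by
  obtain ⟨K, rfl⟩ := Multiset.exists_cons_of_mem h
  rw [hypsWt_cons]
  omega

theorem hypsWt_map (w : PFact Sg → ℕ) (σ τ : Subst Sg) (H : Multiset (PFact Sg)) :
    hypsWt w σ (H.map (PFact.subst τ)) = hypsWt w (σ.comp τ) H := by
  simp [hypsWt, PFact.subst_comp]

theorem hypsWt_sum {ι : Type*} (w : PFact Sg → ℕ) (σ : Subst Sg) (s : Finset ι)
    (H : ι → Multiset (PFact Sg)) : hypsWt w σ (∑ i ∈ s, H i) = ∑ i ∈ s, hypsWt w σ (H i) := by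
  classical
  induction s using Finset.induction_on with
  | empty => simp [hypsWt]
  | insert a s ha ih => rw [Finset.sum_insert ha, Finset.sum_insert ha, hypsWt_add, ih]

/-! ### Instances of clauses with derivable hypotheses -/

/-- `G` is the conclusion of an instance of `R` whose hypotheses are derivable with total weight at
most `n`. -/
def Inst (Dv : Set (PFact Sg)) (w : PFact Sg → ℕ) (R : Clause Sg) (G : PFact Sg) (n : ℕ) : Prop :=
  ∃ σ : Subst Sg, R.concl.subst σ = G ∧ (∀ F ∈ R.hyps, Drv Dv (F.subst σ)) ∧
    hypsWt w σ R.hyps ≤ n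

variable {Dv : Set (PFact Sg)} {w : PFact Sg → ℕ}

theorem Inst.mono {R : Clause Sg} {G : PFact Sg} {n m : ℕ} (h : Inst Dv w R G n) (hn : n ≤ m) :
    Inst Dv w R G m := by
  obtain ⟨σ, h1, h2, h3⟩ := h
  exact ⟨σ, h1, h2, h3.trans hn⟩

theorem Inst.of_le {R R' : Clause Sg} {G : PFact Sg} {n : ℕ} (h : Inst Dv w R G n)
    (hc : R'.concl = R.concl) (hH : R'.hyps ≤ R.hyps) : Inst Dv w R' G n := by
  obtain ⟨σ, h1, h2, h3⟩ := h
  exact ⟨σ, hc ▸ h1, fun F hF => h2 F (Multiset.mem_of_le hH hF), (hypsWt_mono w σ hH).trans h3⟩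

/-- Subsumption uses multiset inclusion, so passing to the subsuming clause cannot increase the
weight of the hypotheses. -/
theorem Inst.of_subsumes {R R' : Clause Sg} {G : PFact Sg} {n : ℕ} (h : Inst Dv w R G n)
    (hs : R'.Subsumes R) : Inst Dv w R' G n := by
  obtain ⟨σ, h1, h2, h3⟩ := h
  obtain ⟨τ, h4, h5⟩ := hs
  refine ⟨σ.comp τ, by rw [PFact.subst_comp, h4, h1], fun F hF => ?_, ?_⟩
  · rw [PFact.subst_comp]
    exact h2 _ (Multiset.mem_of_le h5 (Multiset.mem_map_of_mem _ hF))
  · rw [← hypsWt_map]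
    exact (hypsWt_mono w σ h5).trans h3

theorem Clause.Subsumes.trans {R₁ R₂ R₃ : Clause Sg} (h : R₁.Subsumes R₂) (h' : R₂.Subsumes R₃) :
    R₁.Subsumes R₃ := by
  obtain ⟨σ, h1, h2⟩ := h
  obtain ⟨τ, h3, h4⟩ := h'
  refine ⟨τ.comp σ, by rw [PFact.subst_comp, h1, h3], ?_⟩
  have : R₁.hyps.map (PFact.subst (τ.comp σ)) = (R₁.hyps.map (PFact.subst σ)).map (PFact.subst τ) := by
    rw [Multiset.map_map]
    exact Multiset.map_congr rfl fun F _ => PFact.subst_comp τ σ F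
  rw [this]
  exact (Multiset.map_le_map h2).trans h4

theorem PFact.subst_id (F : PFact Sg) : F.subst ⟨Pat.var, Sid.var⟩ = F := by
  have hs : ∀ j : Sid, j.subst Sid.var = j := fun j => by cases j <;> rfl
  have key : ∀ p : Pat Sg, p.subst ⟨Pat.var, Sid.var⟩ = p := by
    intro p
    induction p with
    | var x => rfl
    | nm a n ps is ih =>
      simp only [Pat.subst, ih]
      congr 1
      exact (List.map_congr_left fun j _ => hs j).trans (List.map_id _)
    | app f ps ih => simp only [Pat.subst, ih]
  cases F <;> simp only [PFact.subst, key]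

theorem Clause.subsumes_of_le {R R' : Clause Sg} (hc : R'.concl = R.concl)
    (hH : R'.hyps ≤ R.hyps) : R'.Subsumes R := by
  refine ⟨⟨Pat.var, Sid.var⟩, by rw [PFact.subst_id, hc], ?_⟩
  rw [Multiset.map_congr rfl fun F _ => PFact.subst_id F, Multiset.map_id']
  exact hH

/-! ### Resolution -/

theorem renSubst_cancel (π πs : Equiv.Perm ℕ) (σ : Subst Sg) :
    (Subst.comp ⟨fun x => σ.o (π.symm x), fun i => σ.s (πs.symm i)⟩ (renSubst π πs)) = σ := by
  ext x
  · simp [Subst.comp, renSubst, Pat.subst]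
  · simp [Subst.comp, renSubst, Sid.subst]

open Classical in
-- The lifting property of resolution: any two instances that match on the resolved fact are
-- combined by an instance of the resolvent.
theorem IsResolvent.exists_subst {R R' R'' : Clause Sg} {F₀ : PFact Sg}
    (h : IsResolvent R F₀ R' R'') {σ₁ σ : Subst Sg} (he : R.concl.subst σ₁ = F₀.subst σ) :
    ∃ θ : Subst Sg, R''.concl.subst θ = R'.concl.subst σ ∧
      R''.hyps.map (PFact.subst θ) =
        R.hyps.map (PFact.subst σ₁) + (R'.hyps.erase F₀).map (PFact.subst σ) := by
  obtain ⟨hF₀, π, πs, R₁, μ, rfl, hdo, hds, hmg, rfl⟩ := h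
  set R₁ := R.subst (renSubst π πs) with hR₁
  let σ₂ : Subst Sg := ⟨fun x => σ₁.o (π.symm x), fun i => σ₁.s (πs.symm i)⟩
  -- The two instances are glued into one substitution; the variables being apart, τ acts as each of
  -- them on its own clause.
  let τ : Subst Sg := ⟨fun x => if x ∈ R₁.ovars then σ₂.o x else σ.o x,
    fun i => if i ∈ R₁.svars then σ₂.s i else σ.s i⟩
  have hσ₂ : ∀ F : PFact Sg, (F.subst (renSubst π πs)).subst σ₂ = F.subst σ₁ := fun F => by
    rw [← PFact.subst_comp, renSubst_cancel]
  have hl : ∀ F : PFact Sg, F.ovars ⊆ R₁.ovars → F.svars ⊆ R₁.svars → F.subst τ = F.subst σ₂ :=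
    fun F ho hs => F.subst_congr (fun x hx => if_pos (ho hx)) (fun x hx => if_pos (hs hx))
  have hr : ∀ F : PFact Sg, F.ovars ⊆ R'.ovars → F.svars ⊆ R'.svars → F.subst τ = F.subst σ :=
    fun F ho hs => F.subst_congr
      (fun x hx => if_neg fun h => Set.disjoint_left.1 hdo h (ho hx))
      (fun x hx => if_neg fun h => Set.disjoint_left.1 hds h (hs hx))
  have hr' : ∀ F ∈ R'.hyps, F.subst τ = F.subst σ := fun F hF =>
    hr F (fun x hx => Or.inl ⟨F, hF, hx⟩) (fun x hx => Or.inl ⟨F, hF, hx⟩)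
  have hτ : R₁.concl.subst τ = F₀.subst τ := by
    rw [hr' F₀ hF₀, hl _ Set.subset_union_right Set.subset_union_right, ← he]
    exact hσ₂ _
  obtain ⟨θ, hθ⟩ := hmg.2 τ hτ
  have hθ' : ∀ F : PFact Sg, (F.subst μ).subst θ = F.subst τ := fun F => by
    rw [hθ, PFact.subst_comp]
  refine ⟨θ, ?_, ?_⟩
  · rw [hθ', hr _ Set.subset_union_right Set.subset_union_right]
  · rw [Multiset.map_map, Multiset.map_add]
    congr 1
    · simp only [hR₁, Clause.subst, Multiset.map_map]
      refine Multiset.map_congr rfl fun F hF => ?_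
      have hmem : F.subst (renSubst π πs) ∈ R₁.hyps := Multiset.mem_map_of_mem _ hF
      simp only [Function.comp, hθ']
      rw [hl _ (fun x hx => Or.inl ⟨_, hmem, hx⟩) (fun x hx => Or.inl ⟨_, hmem, hx⟩), hσ₂]
    · refine Multiset.map_congr rfl fun F hF => ?_
      simp only [Function.comp, hθ']
      exact hr' F (Multiset.mem_of_mem_erase hF)

/-- The weight of the resolved hypothesis is replaced by that of the hypotheses used to derive it.
-/
theorem IsResolvent.inst {R R' R'' : Clause Sg} {F₀ : PFact Sg} {m : ℕ}
    (h : IsResolvent R F₀ R' R'') {σ : Subst Sg} (hR : Inst Dv w R (F₀.subst σ) m)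
    {K : Multiset (PFact Sg)} (hK : R'.hyps = F₀ ::ₘ K) (hR' : ∀ F ∈ K, Drv Dv (F.subst σ)) :
    Inst Dv w R'' (R'.concl.subst σ) (hypsWt w σ K + m) := by
  classical
  obtain ⟨σ₁, h1, h2, h3⟩ := hR
  obtain ⟨θ, h4, h5⟩ := h.exists_subst h1
  rw [hK, Multiset.erase_cons_head] at h5
  refine ⟨θ, h4, fun F hF => ?_, ?_⟩
  · have := Multiset.mem_map_of_mem (PFact.subst θ) hF
    rw [h5, Multiset.mem_add, Multiset.mem_map, Multiset.mem_map] at this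
    rcases this with ⟨F', hF', e⟩ | ⟨F', hF', e⟩
    · exact e ▸ h2 F' hF'
    · exact e ▸ hR' F' hF'
  · have e1 : hypsWt w θ R''.hyps =
        ((R''.hyps.map (PFact.subst θ)).map (PFact.wt w)).sum := by
      simp [hypsWt]
    have e3 : hypsWt w θ R''.hyps = hypsWt w σ₁ R.hyps + hypsWt w σ K := by
      rw [e1, h5]
      simp [hypsWt]
    omega

/-! ### Simplification -/

theorem leaf_decomp (σ : Subst Sg) (p : Pat Sg) {q : Pat Sg} (hq : q ∈ p.decomp) {d : ℕ}
    {A : PFact Sg} (h : Leaf (.attacker (q.subst σ)) d A) :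
    ∃ d', Leaf (.attacker (p.subst σ)) d' A := by
  induction p with
  | var x =>
    rw [Multiset.mem_singleton.1 hq] at h
    exact ⟨d, h⟩
  | nm a n ps is _ =>
    rw [Multiset.mem_singleton.1 hq] at h
    exact ⟨d, h⟩
  | app f ps ih =>
    by_cases hf : Sg.IsData f
    · simp only [Pat.decomp, if_pos hf, Multiset.mem_sum, Finset.mem_univ, true_and] at hq
      obtain ⟨i, hi⟩ := hq
      obtain ⟨d', h'⟩ := ih i hi
      exact ⟨d' + 1, .arg f hf _ i d' A h'⟩
    · simp only [Pat.decomp, if_neg hf, Multiset.mem_singleton] at hq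
      rw [hq] at h
      exact ⟨d, h⟩

/-- A variable of p may be instantiated by a composed pattern, so part of the decomposition of the
instance can remain to be done below q. Decomposing p first only shortens it. -/
theorem exists_leaf_decomp (σ : Subst Sg) (p : Pat Sg) {d : ℕ} {A : PFact Sg}
    (h : Leaf (.attacker (p.subst σ)) d A) :
    ∃ q ∈ p.decomp, ∃ d' ≤ d, Leaf (.attacker (q.subst σ)) d' A := by
  induction p generalizing d with
  | var x => exact ⟨_, Multiset.mem_singleton_self _, d, le_rfl, h⟩
  | nm a n ps is _ => exact ⟨_, Multiset.mem_singleton_self _, d, le_rfl, h⟩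
  | app f ps ih =>
    by_cases hf : Sg.IsData f
    · obtain ⟨i, d', rfl, h'⟩ := Leaf.of_app hf h
      obtain ⟨q, hq, d'', hd, h''⟩ := ih i h'
      refine ⟨q, ?_, d'', by omega, h''⟩
      simp only [Pat.decomp, if_pos hf, Multiset.mem_sum, Finset.mem_univ, true_and]
      exact ⟨i, hq⟩
    · refine ⟨.app f ps, ?_, d, le_rfl, h⟩
      simp only [Pat.decomp, if_neg hf, Multiset.mem_singleton]

/-- Decomposition keeps the components and saves the unit charged for each removed constructor. -/
theorem hypsWt_decomp_pat (σ : Subst Sg) (p : Pat Sg) :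
    hypsWt w σ (p.decomp.map PFact.attacker) ≤ (PFact.attacker (p.subst σ)).wt w := by
  induction p with
  | var x => simp [Pat.decomp, hypsWt, PFact.subst]
  | nm a n ps is _ => simp [Pat.decomp, hypsWt, PFact.subst]
  | app f ps ih =>
    by_cases hf : Sg.IsData f
    · have e : (∑ i, (ps i).decomp).map PFact.attacker =
          ∑ i, (ps i).decomp.map (PFact.attacker (Sg := Sg)) :=
        map_sum (Multiset.mapAddMonoidHom PFact.attacker) _ _
      simp only [Pat.decomp, if_pos hf, e, hypsWt_sum, Pat.subst]
      rw [PFact.wt_app w hf]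
      exact (Finset.sum_le_sum fun i _ => ih i).trans (Nat.le_add_left _ _)
    · simp [Pat.decomp, if_neg hf, hypsWt, PFact.subst]

theorem hypsWt_decomp (σ : Subst Sg) (F : PFact Sg) :
    hypsWt w σ F.decomp ≤ (F.subst σ).wt w := by
  cases F with
  | attacker p => exact hypsWt_decomp_pat σ p
  | _ => simp [PFact.decomp, hypsWt]

theorem hypsWt_bind_decomp (σ : Subst Sg) (H : Multiset (PFact Sg)) :
    hypsWt w σ (H.bind PFact.decomp) ≤ hypsWt w σ H := by
  induction H using Multiset.induction_on with
  | empty => simp [hypsWt]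
  | cons F H ih =>
    rw [Multiset.cons_bind, hypsWt_add, hypsWt_cons]
    exact Nat.add_le_add (hypsWt_decomp σ F) ih

theorem Drv.decomp {σ : Subst Sg} {F F' : PFact Sg} (h : Drv Dv (F.subst σ)) (hF : F' ∈ F.decomp) :
    Drv Dv (F'.subst σ) := by
  cases F with
  | attacker p =>
    obtain ⟨q, hq, rfl⟩ := Multiset.mem_map.1 hF
    intro d A hA
    obtain ⟨d', h'⟩ := leaf_decomp σ p hq hA
    exact h d' A h'
  | _ =>
    rw [Multiset.mem_singleton.1 hF]
    exact h

theorem Inst.decompHyps {R : Clause Sg} {G : PFact Sg} {n : ℕ} (h : Inst Dv w R G n) :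
    Inst Dv w ⟨R.hyps.bind PFact.decomp, R.concl⟩ G n := by
  obtain ⟨σ, h1, h2, h3⟩ := h
  refine ⟨σ, h1, fun F hF => ?_, (hypsWt_bind_decomp σ _).trans h3⟩
  obtain ⟨F', hF', hF⟩ := Multiset.mem_bind.1 hF
  exact (h2 F' hF').decomp hF

theorem PFact.exists_leaf_decomp {F A : PFact Sg} {σ : Subst Sg} {d : ℕ}
    (h : Leaf (F.subst σ) d A) : ∃ C ∈ F.decomp, ∃ d' ≤ d, Leaf (C.subst σ) d' A := by
  cases F with
  | attacker p =>
    obtain ⟨q, hq, d', hd, h'⟩ := PV.exists_leaf_decomp σ p h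
    exact ⟨_, Multiset.mem_map_of_mem _ hq, d', hd, h'⟩
  | _ => exact ⟨_, Multiset.mem_singleton_self _, d, le_rfl, h⟩

/-- All that completeness needs from this simplification is that it drops hypotheses; why they are
redundant plays no role. -/
theorem ElimRedundantHyp.le {R R' : Clause Sg} (h : ElimRedundantHyp R R') :
    R'.concl = R.concl ∧ R'.hyps ≤ R.hyps := by
  induction h with
  | refl => exact ⟨rfl, le_rfl⟩
  | tail _ hs ih =>
    obtain ⟨hc, H, _, hH, _⟩ := hs
    exact ⟨hc.trans ih.1, (hH ▸ Multiset.le_add_left _ _).trans ih.2⟩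

theorem ElimRedundantHyp.le_of_elimDup {R R' : Clause Sg} (h : ElimRedundantHyp (elimDup R) R') :
    R'.concl = R.concl ∧ R'.hyps ≤ R.hyps := by
  classical
  refine ⟨h.le.1, h.le.2.trans ?_⟩
  unfold elimDup
  convert Multiset.dedup_le R.hyps

theorem elimAttX_le (R : Clause Sg) : (elimAttX R).concl = R.concl ∧ (elimAttX R).hyps ≤ R.hyps :=
  ⟨rfl, by classical exact Multiset.filter_le _ _⟩

/-- No instance of a fact of `Fnot` is derivable with weight less than `k`. -/
def Avoids (Dv : Set (PFact Sg)) (w : PFact Sg → ℕ) (Fnot : Set (PFact Sg)) (k : ℕ) : Prop :=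
  ∀ F ∈ Fnot, ∀ σ : Subst Sg, Drv Dv (F.subst σ) → k ≤ (F.subst σ).wt w

/-- A forbidden hypothesis would yield a derivable instance of a fact of `Fnot` weighing at most n.
-/
theorem Avoids.not_forbiddenBy {Fnot : Set (PFact Sg)} {k : ℕ} (hN : Avoids Dv w Fnot k)
    {R : Clause Sg} {G : PFact Sg} {n : ℕ} (h : Inst Dv w R G n) (hn : n < k) :
    ¬ ForbiddenBy Fnot R := by
  rintro ⟨F, hF, F', hF', τ, rfl⟩
  obtain ⟨σ, _, h2, h3⟩ := h
  have h4 := hN F' hF' (σ.comp τ) (by rw [PFact.subst_comp]; exact h2 _ hF)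
  rw [PFact.subst_comp] at h4
  have := wt_le_hypsWt w σ hF
  omega

theorem SimplifyHyp.exists_inst {Fnot : Set (PFact Sg)} {k : ℕ} (hN : Avoids Dv w Fnot k)
    {R : Clause Sg} {𝒮 : Set (Clause Sg)} (hS : SimplifyHyp Fnot R 𝒮) {G : PFact Sg} {n : ℕ}
    (h : Inst Dv w R G n) (hn : n < k) : ∃ R' ∈ 𝒮, Inst Dv w R' G n := by
  obtain ⟨R', hR', rfl⟩ := hS
  have h1 : Inst Dv w (decompHyp R) G n := by
    unfold decompHyp
    split_ifs
    exacts [h, h.decompHyps]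
  have h2 := h1.of_le hR'.le_of_elimDup.1 hR'.le_of_elimDup.2
  exact ⟨_, ⟨hN.not_forbiddenBy h2 hn, rfl⟩, h2.of_le (elimAttX_le _).1 (elimAttX_le _).2⟩

/-- The clause `R` yields the component `A` with total weight at most `v`. -/
def StepOf (Dv : Set (PFact Sg)) (w : PFact Sg → ℕ) (R : Clause Sg) (A : PFact Sg) (v : ℕ) :
    Prop :=
  ∃ G d n, Inst Dv w R G n ∧ Leaf G d A ∧ 1 + 2 * d + n ≤ v

/-- Decomposing the conclusion moves stripping from the cost of use into the clause. The bound v ≤ w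
A saves the clause from the tautology test, and w A ≤ k saves it from `Fnot`. -/
theorem Simplify.exists_stepOf {Fnot : Set (PFact Sg)} {k : ℕ} (hN : Avoids Dv w Fnot k)
    {R : Clause Sg} {𝒮 : Set (Clause Sg)} (hS : Simplify Fnot R 𝒮) {A : PFact Sg} {v : ℕ}
    (h : StepOf Dv w R A v) (hv : v ≤ w A) (hk : w A ≤ k) : ∃ R' ∈ 𝒮, StepOf Dv w R' A v := by
  obtain ⟨r, hr, rfl⟩ := hS
  have h1 : ∃ R₁ ∈ decompAll R, StepOf Dv w R₁ A v := by
    unfold decompAll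
    split_ifs
    · exact ⟨R, rfl, h⟩
    · obtain ⟨G, d, n, hI, hL, hle⟩ := h
      obtain ⟨σ, rfl, h2, h3⟩ := hI.decompHyps
      obtain ⟨C, hC, d', hd, hL'⟩ := PFact.exists_leaf_decomp hL
      exact ⟨_, ⟨C, hC, rfl⟩, _, d', n, ⟨σ, rfl, h2, h3⟩, hL', by omega⟩
  obtain ⟨R₁, hR₁, G, d, n, hI, hL, hle⟩ := h1
  have h2 := hI.of_le (hr R₁ hR₁).le_of_elimDup.1 (hr R₁ hR₁).le_of_elimDup.2
  refine ⟨_, ⟨R₁, hR₁, hN.not_forbiddenBy h2 (by omega), ?_, rfl⟩, G, d, n,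
    h2.of_le (elimAttX_le _).1 (elimAttX_le _).2, hL, hle⟩
  -- In a tautology the conclusion is also a hypothesis, so w A ≤ n, against 1 + 2 * d + n ≤ v ≤ w
  -- A.
  intro ht
  obtain ⟨σ, rfl, _, h3⟩ := h2
  have h4 := wt_le_hypsWt w σ ht
  have h5 := hL.wt_le w
  omega

end

section
variable {Sg : Signature.{u, v}} {Dv : Set (PFact Sg)} {w : PFact Sg → ℕ}

/-! ### Completeness of saturation -/

theorem StepOf.of_subsumes {R R' : Clause Sg} {A : PFact Sg} {v : ℕ} (h : StepOf Dv w R A v)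
    (hs : R'.Subsumes R) : StepOf Dv w R' A v := by
  obtain ⟨G, d, n, hI, h⟩ := h
  exact ⟨G, d, n, hI.of_subsumes hs, h⟩

/-- The property `Φ` of clauses is inherited by subsuming clauses. -/
def Upward (Φ : Clause Sg → Prop) : Prop := ∀ R R', Φ R → R'.Subsumes R → Φ R'

theorem AddClause.exists_of_simplify {Φ : Clause Sg → Prop} (hΦ : Upward Φ)
    {Fnot : Set (PFact Sg)} {R : Clause Sg} {𝓡 𝓡' : Set (Clause Sg)}
    (h : AddClause Fnot R 𝓡 𝓡') (hR : ∀ 𝒮, Simplify Fnot R 𝒮 → ∃ R' ∈ 𝒮, Φ R') :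
    ∃ R' ∈ 𝓡', Φ R' := by
  obtain ⟨𝒮, hS, _, hE, _⟩ := h
  obtain ⟨R', hR', h'⟩ := hR 𝒮 hS
  obtain ⟨R'', hR'', hs⟩ := hE R' (Or.inl hR')
  exact ⟨R'', hR'', hΦ _ _ h' hs⟩

theorem AddClause.exists_of_mem {Φ : Clause Sg → Prop} (hΦ : Upward Φ)
    {Fnot : Set (PFact Sg)} {R : Clause Sg} {𝓡 𝓡' : Set (Clause Sg)}
    (h : AddClause Fnot R 𝓡 𝓡') (hR : ∃ R' ∈ 𝓡, Φ R') : ∃ R' ∈ 𝓡', Φ R' := by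
  obtain ⟨𝒮, hS, _, hE, _⟩ := h
  obtain ⟨R', hR', h'⟩ := hR
  obtain ⟨R'', hR'', hs⟩ := hE R' (Or.inr hR')
  exact ⟨R'', hR'', hΦ _ _ h' hs⟩

theorem AddClauses.exists_of_simplify {Φ : Clause Sg → Prop} (hΦ : Upward Φ)
    {Fnot : Set (PFact Sg)} {L : List (Clause Sg)} {𝓡 𝓡' : Set (Clause Sg)}
    (h : AddClauses Fnot L 𝓡 𝓡')
    (hR : (∃ R ∈ 𝓡, Φ R) ∨ ∃ R ∈ L, ∀ 𝒮, Simplify Fnot R 𝒮 → ∃ R' ∈ 𝒮, Φ R') :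
    ∃ R' ∈ 𝓡', Φ R' := by
  induction h with
  | nil 𝓡 =>
    rcases hR with hR | ⟨R, hR, _⟩
    · exact hR
    · exact absurd hR List.not_mem_nil
  | cons R L 𝓡 𝓡' 𝓡'' h hL ih =>
    rcases hR with hR | ⟨R', hR', hS⟩
    · exact ih (Or.inl (h.exists_of_mem hΦ hR))
    · rcases List.mem_cons.1 hR' with rfl | hR'
      · exact ih (Or.inl (h.exists_of_simplify hΦ hS))
      · exact ih (Or.inr ⟨R', hR', hS⟩)

variable {s : SelectionFunction Sg} {Fnot : Set (PFact Sg)} {𝓡 : Set (Clause Sg)} {k : ℕ}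

/-- At a fixpoint, adding the resolvent changes nothing, so some clause already present subsumes the
relevant part of its simplification and inherits its cost bound. -/
theorem IsFixpoint.exists_stepOf (hfix : IsFixpoint s Fnot 𝓡) (hN : Avoids Dv w Fnot k)
    {R R' : Clause Sg} (hR : R ∈ 𝓡) (hsel : s.sel R = ∅) (hR' : R' ∈ 𝓡) {F₀ : PFact Sg}
    (hF₀ : F₀ ∈ s.sel R') {σ : Subst Sg} {m : ℕ} (hI : Inst Dv w R (F₀.subst σ) m)
    {K : Multiset (PFact Sg)} (hK : R'.hyps = F₀ ::ₘ K) (hR'σ : ∀ F ∈ K, Drv Dv (F.subst σ))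
    {A : PFact Sg} {d v : ℕ} (hL : Leaf (R'.concl.subst σ) d A)
    (hle : 1 + 2 * d + (hypsWt w σ K + m) ≤ v) (hv : v ≤ w A) (hk : w A ≤ k) :
    ∃ R ∈ 𝓡, StepOf Dv w R A v := by
  obtain ⟨σ₁, h1, _⟩ := id hI
  obtain ⟨R'', hres, hadd⟩ :=
    hfix R hR hsel R' hR' F₀ hF₀ ⟨s.subset_hyps R' F₀ hF₀, σ₁, σ, h1⟩
  refine hadd.exists_of_simplify (fun _ _ h hs => h.of_subsumes hs) fun 𝒮 hS => ?_
  exact hS.exists_stepOf hN ⟨_, d, _, hres.inst hI hK hR'σ, hL, hle⟩ hv hk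

/-! ### Projections of data constructors and the fixpoint -/

/-- The clause `attacker(f(x₁, …, xₙ)) ⇒ attacker(xᵢ)`. -/
def projClause (f : Sg.Con) (x : Fin (Sg.conArity f) → ℕ) (i : Fin (Sg.conArity f)) : Clause Sg :=
  ⟨{.attacker (.app f (fun j => .var (x j)))}, .attacker (.var (x i))⟩

/-- The pattern `b₀[x]`. -/
def Pat.b0 (Sg : Signature.{u, v}) : Pat Sg := .nm .b0 1 (fun _ => .var 0) []

theorem Pat.b0_not_isComposed : ¬ (PFact.attacker (Pat.b0 Sg)).IsComposed := by
  rintro ⟨_, _, _, h⟩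
  cases h

/-- Instances of data constructors can be projected, or no projection is ever needed. -/
def Projects (Dv : Set (PFact Sg)) (w : PFact Sg → ℕ) (𝓡 : Set (Clause Sg)) : Prop :=
  (.attacker (Pat.b0 Sg) ∈ Dv ∧ w (.attacker (Pat.b0 Sg)) ≤ 1 ∧
    ∀ f, Sg.IsData f → ∀ i, ∃ x : Fin (Sg.conArity f) → ℕ, Function.Injective x ∧
      ∃ R ∈ 𝓡, R.Subsumes (projClause f x i)) ∨ ∀ A ∈ Dv, w A ≤ 1

theorem Leaf.eq_attacker {F A : PFact Sg} {d : ℕ} (h : Leaf F d A) (hF : ∃ p, F = .attacker p) :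
    ∃ p, A = .attacker p := by
  induction h with
  | self F _ => exact hF
  | arg _ _ ps i _ _ _ ih => exact ih ⟨_, rfl⟩

theorem not_mevent_of_selected {R : Clause Sg} {F : PFact Sg} (h : F ∈ s.sel R) (σ : Subst Sg) :
    ¬ ∃ p, F.subst σ = .mevent p := by
  rintro ⟨p, hp⟩
  refine s.selectable R F h (Or.inr ?_)
  cases F with
  | mevent q => exact ⟨q, rfl⟩
  | _ => cases hp

/-- Resolving with a projection strips one data constructor from the conclusion of R. Saturation may
have replaced the projection by a more general clause R₂, so the case where R₂ has nothing to select
is treated apart; it is what makes a stripped constructor cost 2 and not 1. -/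
theorem exists_stepOf_proj (hfix : IsFixpoint s Fnot 𝓡) (hN : Avoids Dv w Fnot k)
    (hb : PFact.attacker (Pat.b0 Sg) ∈ Dv) (hwb : w (.attacker (Pat.b0 Sg)) ≤ 1)
    {f : Sg.Con} {x : Fin (Sg.conArity f) → ℕ} (hx : Function.Injective x)
    {i : Fin (Sg.conArity f)} {R₂ : Clause Sg} (hR₂ : R₂ ∈ 𝓡)
    (hs : R₂.Subsumes (projClause f x i)) {R : Clause Sg} (hR : R ∈ 𝓡) (hsel : s.sel R = ∅)
    {ps : Fin (Sg.conArity f) → Pat Sg} {n : ℕ} (hI : Inst Dv w R (.attacker (.app f ps)) n)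
    {A : PFact Sg} {d v : ℕ} (hL : Leaf (.attacker (ps i)) d A)
    (hle : 1 + 2 * (d + 1) + n ≤ v + 1) (hv : v ≤ w A) (hk : w A ≤ k) :
    ∃ R ∈ 𝓡, StepOf Dv w R A v := by
  obtain ⟨τ, hc, hh⟩ := hs
  obtain ⟨y, hy, hyx⟩ : ∃ y, R₂.concl = .attacker (.var y) ∧ τ.o y = .var (x i) := by
    change _ = PFact.attacker (.var (x i)) at hc
    rcases hR₂c : R₂.concl with p | _ | _ | _ <;> rw [hR₂c] at hc
    · rcases p with y | _ | _
      · exact ⟨y, rfl, by injection hc⟩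
      all_goals injection hc with h; cases h
    all_goals cases hc
  have hmem : ∀ F ∈ R₂.hyps, F.subst τ = .attacker (.app f fun j => .var (x j)) := fun F hF =>
    Multiset.mem_singleton.1 (Multiset.mem_of_le hh (Multiset.mem_map_of_mem _ hF))
  have hcard : R₂.hyps.card ≤ 1 := by
    simpa [projClause] using Multiset.card_le_card hh
  by_cases hu : ∃ F ∈ R₂.hyps, ¬ Unselectable F
  -- The conclusion of R₂ is attacker of a variable, so a selectable hypothesis forces a nonempty
  -- selection.
  · obtain ⟨F₀, hF₀⟩ := s.nonempty R₂ ⟨y, hy⟩ hu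
    have hF₀h := s.subset_hyps _ _ hF₀
    obtain ⟨K, hK⟩ := Multiset.exists_cons_of_mem hF₀h
    have hK0 : K = 0 := by
      rw [hK, Multiset.card_cons] at hcard
      exact Multiset.card_eq_zero.1 (by omega)
    subst hK0
    let δ : Subst Sg := ⟨Function.extend x ps Pat.var, Sid.var⟩
    have hδ : ∀ j, δ.o (x j) = ps j := fun j => hx.extend_apply _ _ _
    have e1 : F₀.subst (δ.comp τ) = .attacker (.app f ps) := by
      rw [PFact.subst_comp, hmem _ hF₀h]
      simp only [PFact.subst, Pat.subst, hδ]
    have e2 : R₂.concl.subst (δ.comp τ) = .attacker (ps i) := by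
      rw [hy]
      simp only [PFact.subst, Pat.subst, Subst.comp, hyx, hδ]
    refine hfix.exists_stepOf hN hR hsel hR₂ hF₀ (σ := δ.comp τ) (e1 ▸ hI) hK
      (fun F hF => absurd hF (Multiset.notMem_zero F)) (e2 ▸ hL) ?_ hv hk
    simp only [hypsWt, Multiset.map_zero, Multiset.sum_zero]
    omega
  · push Not at hu
    obtain ⟨a, rfl⟩ := hL.eq_attacker ⟨_, rfl⟩
    -- Here R₂ has at most one hypothesis, attacker(z) with z ≠ y. Sending z to b₀[x], of weight at
    -- most 1, derives any attacker fact at cost at most 2.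
    let σ : Subst Sg := ⟨fun z => if z = y then a else Pat.b0 Sg, Sid.var⟩
    have hz : ∀ F ∈ R₂.hyps, F.subst σ = .attacker (Pat.b0 Sg) := by
      intro F hF
      have e := hmem F hF
      rcases hu F hF with ⟨z, rfl⟩ | ⟨p, rfl⟩
      · have hzy : z ≠ y := by
          rintro rfl
          simp only [PFact.subst, Pat.subst, hyx] at e
          cases e
        simp [PFact.subst, Pat.subst, σ, hzy]
      · cases e
    refine ⟨R₂, hR₂, .attacker a, 0, 1, ⟨σ, ?_, fun F hF => ?_, ?_⟩, .self _ hL.not_isComposed,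
      by omega⟩
    · rw [hy]
      simp [PFact.subst, Pat.subst, σ]
    · rw [hz F hF]
      intro d A hA
      rw [(Leaf.eq_of_not_isComposed Pat.b0_not_isComposed hA).2]
      exact hb
    · have : hypsWt w σ R₂.hyps = (R₂.hyps.map fun _ => w (.attacker (Pat.b0 Sg))).sum := by
        unfold hypsWt
        congr 1
        refine Multiset.map_congr rfl fun F hF => ?_
        rw [hz F hF, PFact.wt_of_not_isComposed w Pat.b0_not_isComposed]
      rw [this, Multiset.map_const', Multiset.sum_replicate, smul_eq_mul]
      exact (Nat.mul_le_mul hcard hwb)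

/-- Every derivable fact is the conclusion of an instance of a clause without selected hypothesis,
with hypotheses of smaller weight. -/
theorem IsFixpoint.exists_inst (hfix : IsFixpoint s Fnot 𝓡) (hN : Avoids Dv w Fnot k)
    (hstep : ∀ A ∈ Dv, w A ≤ k → (∃ p, A = .mevent p) ∨ ∃ R ∈ 𝓡, StepOf Dv w R A (w A))
    (hRf : ∀ f, Sg.IsData f → ∃ R ∈ 𝓡, R.Subsumes (clauseRf f (fun i => i)))
    (hproj : Projects Dv w 𝓡) (G : PFact Sg) (hG : Drv Dv G) (hme : ¬ ∃ p, G = .mevent p)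
    (hk : G.wt w ≤ k) :
    ∃ R ∈ 𝓡, s.sel R = ∅ ∧ ∃ m, Inst Dv w R G m ∧ 1 + m ≤ G.wt w := by
  induction hn : G.wt w using Nat.strong_induction_on generalizing G with
  | _ n ih =>
  subst hn
  by_cases hcomp : G.IsComposed
  · obtain ⟨f, ps, hf, rfl⟩ := hcomp
    obtain ⟨R, hR, hs⟩ := hRf f hf
    refine ⟨R, hR, ?_, ∑ i, (PFact.attacker (ps i)).wt w, Inst.of_subsumes ?_ hs, ?_⟩
    -- Hypotheses of R have an instance of the form attacker(x), so they are themselves of that form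
    -- and cannot be selected.
    · by_contra hne
      obtain ⟨F, hF⟩ := Set.nonempty_iff_ne_empty.2 hne
      obtain ⟨τ, _, hh⟩ := hs
      have h1 := Multiset.mem_of_le hh (Multiset.mem_map_of_mem _ (s.subset_hyps _ _ hF))
      obtain ⟨i, hi⟩ := mem_clauseRf_hyps.1 h1
      refine s.selectable _ _ hF (Or.inl ?_)
      rcases F with p | _ | _ | _
      · rcases p with y | _ | _
        · exact ⟨y, rfl⟩
        all_goals injection hi with h; cases h
      all_goals cases hi
    · let σ : Subst Sg :=
        ⟨fun y => if hy : y < Sg.conArity f then ps ⟨y, hy⟩ else .var 0, Sid.var⟩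
      have hσ : ∀ i : Fin (Sg.conArity f), σ.o i = ps i := fun i => by simp [σ]
      refine ⟨σ, ?_, fun F hF => ?_, ?_⟩
      · simp only [clauseRf, PFact.subst, Pat.subst, hσ]
      · obtain ⟨i, rfl⟩ := mem_clauseRf_hyps.1 hF
        simp only [PFact.subst, Pat.subst, hσ]
        exact fun d A hA => hG _ A (.arg f hf ps i d A hA)
      · simp only [hypsWt, clauseRf, Multiset.map_map, Function.comp_def, PFact.subst, Pat.subst, hσ]
        exact le_rfl
    · rw [PFact.wt_app w hf]
  · have hw := G.wt_of_not_isComposed w hcomp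
    have hGD : G ∈ Dv := hG 0 G (.self G hcomp)
    -- Among all clauses of the fixpoint that yield G, one of least cost is taken; every remaining
    -- bad case produces a cheaper one.
    have hex : ∃ v, ∃ R ∈ 𝓡, StepOf Dv w R G v :=
      ⟨w G, (hstep G hGD (hw ▸ hk)).resolve_left hme⟩
    classical
    have hmin : ∀ v, v + 1 ≤ Nat.find hex → ¬ ∃ R ∈ 𝓡, StepOf Dv w R G v :=
      fun v hv => Nat.find_min hex hv
    have hle : Nat.find hex ≤ w G := Nat.find_min' hex ((hstep G hGD (hw ▸ hk)).resolve_left hme)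
    obtain ⟨R, hR, G₁, d, n, hI, hL, hv⟩ := Nat.find_spec hex
    set v := Nat.find hex
    by_cases hsel : s.sel R = ∅
    · rcases d with _ | d
      · cases hL
        exact ⟨R, hR, hsel, n, hI, by omega⟩
      · cases hL with
        | arg f hf ps i _ _ hL =>
        exfalso
        rcases hproj with ⟨hb, hwb, hproj⟩ | h1
        · obtain ⟨x, hx, R₂, hR₂, hs⟩ := hproj f hf i
          exact hmin (v - 1) (by omega) (exists_stepOf_proj hfix hN hb hwb hx hR₂ hs hR hsel hI hL
            (by omega) (by omega) (by omega))
        -- Stripping a constructor costs at least 3 in total, impossible when all weights are at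
        -- most 1.
        · have := h1 G hGD
          omega
    · exfalso
      obtain ⟨F₀, hF₀⟩ := Set.nonempty_iff_ne_empty.2 hsel
      have hF₀h := s.subset_hyps _ _ hF₀
      obtain ⟨K, hK⟩ := Multiset.exists_cons_of_mem hF₀h
      obtain ⟨σ, rfl, hd, hn⟩ := hI
      rw [hK, hypsWt_cons] at hn
      -- The selected hypothesis is lighter than G, so the induction hypothesis gives it a clause
      -- without selection. As 1 + m is at most its weight, resolving gains at least 1.
      obtain ⟨R₁, hR₁, hsel₁, m, hI₁, hm⟩ := ih ((F₀.subst σ).wt w) (by omega) _ (hd F₀ hF₀h)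
        (not_mevent_of_selected hF₀ σ) (by omega) rfl
      exact hmin (v - 1) (by omega) (hfix.exists_stepOf hN hR₁ hsel₁ hR hF₀ hI₁ hK
        (fun F hF => hd F (hK ▸ Multiset.mem_cons_of_mem hF)) hL (by omega) (by omega) (by omega))

/-! ### Completeness of the backward search -/

/-- The invariant is that no clause visited earlier on the branch yields G within weight n.
Subsumption preserves weight bounds, so a visited clause cannot cut the current one. -/
theorem Deriv.exists_inst {𝓡₁ : Set (Clause Sg)} (hN : Avoids Dv w Fnot k)
    (h𝓡₁ : ∀ G : PFact Sg, Drv Dv G → (¬ ∃ p, G = .mevent p) → G.wt w ≤ k →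
      ∃ R ∈ 𝓡₁, ∃ m, Inst Dv w R G m ∧ 1 + m ≤ G.wt w)
    {R : Clause Sg} {𝓥 𝒟 : Set (Clause Sg)} (hD : Deriv s Fnot 𝓡₁ R 𝓥 𝒟) {G : PFact Sg} {n : ℕ}
    (hI : Inst Dv w R G n) (hn : n ≤ k) (h𝓥 : ∀ R' ∈ 𝓥, ¬ Inst Dv w R' G n) :
    ∃ R' ∈ 𝒟, ∃ m, Inst Dv w R' G m := by
  induction hD generalizing n with
  | seen R 𝓥 h =>
    obtain ⟨R', hR', hs⟩ := h
    exact absurd (hI.of_subsumes hs) (h𝓥 R' hR')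
  | done R 𝓥 h hs => exact ⟨R, rfl, n, hI⟩
  | step R 𝓥 h hs next out hnext hout ih =>
    classical
    -- With the least weight for R itself, the resolvent falls below anything R can achieve, so R
    -- may join the visited clauses.
    have hex : ∃ n, Inst Dv w R G n := ⟨n, hI⟩
    have hmin : ∀ m, m + 1 ≤ Nat.find hex → ¬ Inst Dv w R G m := fun m hm => Nat.find_min hex hm
    have hle : Nat.find hex ≤ n := Nat.find_min' hex hI
    obtain ⟨σ, hσ, hd, hn₀⟩ := Nat.find_spec hex
    set n₀ := Nat.find hex
    obtain ⟨F₀, hF₀⟩ := Set.nonempty_iff_ne_empty.2 hs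
    have hF₀h := s.subset_hyps _ _ hF₀
    obtain ⟨K, hK⟩ := Multiset.exists_cons_of_mem hF₀h
    rw [hK, hypsWt_cons] at hn₀
    obtain ⟨R₁, hR₁, m, hI₁, hm⟩ := h𝓡₁ (F₀.subst σ) (hd F₀ hF₀h)
      (not_mevent_of_selected hF₀ σ) (by omega)
    obtain ⟨σ₁, h1, _⟩ := id hI₁
    have hres : Resolvable R₁ F₀ R := ⟨hF₀h, σ₁, σ, h1⟩
    obtain ⟨R'', hR'', hS⟩ := hnext R₁ hR₁ F₀ hF₀ hres
    have h2 := hR''.inst hI₁ hK fun F hF => hd F (hK ▸ Multiset.mem_cons_of_mem hF)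
    rw [hσ] at h2
    -- Simplification needs weight strictly below k; only resolvents are simplified, and they have
    -- lost at least 1.
    obtain ⟨R₃, hR₃, hI₃⟩ := hS.exists_inst hN h2 (by omega)
    obtain ⟨R', hR', hI'⟩ := ih R₁ hR₁ F₀ hF₀ hres R₃ hR₃ hI₃ (by omega) (by
      rintro R' (rfl | hR') h'
      · exact hmin _ (by omega) h'
      · exact h𝓥 R' hR' (h'.mono (by omega)))
    exact ⟨R', ⟨R₁, hR₁, F₀, hF₀, hres, R₃, hR₃, hR'⟩, hI'⟩

end

section
variable {Sg : Signature.{u, v}} {Dv : Set (PFact Sg)} {w : PFact Sg → ℕ}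
variable {s : SelectionFunction Sg} {Fnot : Set (PFact Sg)}

/-! ### Completeness of the solving algorithm -/

/-- Clauses may be discarded later, but only in favour of subsuming ones; hence upward properties
obtained at insertion survive to the fixpoint. -/
theorem Saturates.exists_isFixpoint {𝓡₀ 𝓡₁ : Set (Clause Sg)} (h : Saturates s Fnot 𝓡₀ 𝓡₁) :
    ∃ 𝓡, IsFixpoint s Fnot 𝓡 ∧ 𝓡₁ = {R ∈ 𝓡 | s.sel R = ∅} ∧
      ∀ Φ : Clause Sg → Prop, Upward Φ → ∀ R ∈ 𝓡₀,
        (∀ 𝒮, Simplify Fnot R 𝒮 → ∃ R' ∈ 𝒮, Φ R') → ∃ R' ∈ 𝓡, Φ R' := by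
  obtain ⟨L, 𝓡, 𝓡', hL, hadd, hsat, hfix, rfl⟩ := h
  refine ⟨𝓡', hfix, rfl, fun Φ hΦ R hR hS => ?_⟩
  have h1 := hadd.exists_of_simplify hΦ (Or.inr ⟨R, (hL R).2 hR, hS⟩)
  clear hadd hfix
  induction hsat with
  | refl => exact h1
  | tail _ hstep ih =>
    obtain ⟨_, _, _, _, _, _, _, _, _, hadd⟩ := hstep
    exact hadd.exists_of_mem hΦ ih

/-- Data clauses are exempt from decomposition, which would turn them into tautologies, so the other
steps only drop hypotheses. -/
theorem Simplify.exists_subsumes {R : Clause Sg} {𝒮 : Set (Clause Sg)} (h : Simplify Fnot R 𝒮)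
    (hd : IsDataClause R) (hf : ¬ ForbiddenBy Fnot R) (ht : ¬ Tautology R) :
    ∃ R' ∈ 𝒮, R'.Subsumes R := by
  obtain ⟨r, hr, rfl⟩ := h
  have hR : R ∈ decompAll R := by
    unfold decompAll
    rw [if_pos hd]
    rfl
  obtain ⟨h1, h2⟩ := (hr R hR).le_of_elimDup
  refine ⟨_, ⟨R, hR, fun ⟨F, hF, h⟩ => hf ⟨F, Multiset.mem_of_le h2 hF, h⟩, fun h => ht ?_, rfl⟩,
    Clause.subsumes_of_le ((elimAttX_le _).1.trans h1) ((elimAttX_le _).2.trans h2)⟩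
  rw [Tautology, h1] at h
  exact Multiset.mem_of_le h2 h

theorem upward_subsumes (R : Clause Sg) : Upward (fun R' => R'.Subsumes R) :=
  fun _ _ h hs => hs.trans h

/-- The start clause has F as its only hypothesis, so nothing is selected and it is returned at
once. -/
theorem Deriv.nonempty_of_unselectable {𝓡₁ 𝒟 : Set (Clause Sg)} {F : PFact Sg}
    (hF : Unselectable F) (h : Deriv s Fnot 𝓡₁ ⟨{F}, F⟩ ∅ 𝒟) : 𝒟.Nonempty := by
  cases h with
  | seen _ _ h =>
    obtain ⟨R', hR', _⟩ := h
    exact absurd hR' (Set.notMem_empty R')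
  | done _ _ h hs => exact ⟨_, rfl⟩
  | step _ _ h hs =>
    obtain ⟨F', hF'⟩ := Set.nonempty_iff_ne_empty.2 hs
    have := s.subset_hyps _ _ hF'
    rw [Multiset.mem_singleton] at this
    exact absurd (this ▸ hF) (s.selectable _ _ hF')

theorem clauseRg_eq_projClause {f : Sg.Con} {x : Fin (Sg.conArity f) → ℕ}
    {i : Fin (Sg.conArity f)} {d : ℕ} (hd : d = 1) (r : Rule Sg.Con Sg.conArity d)
    (hl : ∀ j, r.lhs j = .app f (fun k => .var (x k))) (hr : r.rhs = .var (x i)) :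
    clauseRg r = projClause f x i := by
  subst hd
  simp [clauseRg, projClause, hl, hr, RTerm.toPat]

/-- The components that occur in derivations: each of them is obtained in a step from `𝓡₀`. -/
def Stepwise (Dv : Set (PFact Sg)) (w : PFact Sg → ℕ) (𝓡₀ : Set (Clause Sg)) : Prop :=
  ∀ A ∈ Dv, (∃ p, A = .mevent p) ∨ ∃ R ∈ 𝓡₀, StepOf Dv w R A (w A)

/-- Saturation and search combined, relative to pruning that is known to be harmless only below
weight k. This relative form is what the induction on forbidden facts needs. -/
theorem Deriv.exists_inst_of_stepwise {𝓡₀ 𝓡 : Set (Clause Sg)} {k : ℕ}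
    (hfix : IsFixpoint s Fnot 𝓡)
    (hins : ∀ Φ : Clause Sg → Prop, Upward Φ → ∀ R ∈ 𝓡₀,
      (∀ 𝒮, Simplify Fnot R 𝒮 → ∃ R' ∈ 𝒮, Φ R') → ∃ R' ∈ 𝓡, Φ R')
    (hRf : ∀ f, Sg.IsData f → ∃ R ∈ 𝓡, R.Subsumes (clauseRf f (fun i => i)))
    (hst : Stepwise Dv w 𝓡₀) (hproj : Projects Dv w 𝓡) (hN : Avoids Dv w Fnot k) {F : PFact Sg}
    {𝒟 : Set (Clause Sg)} (hD : Deriv s Fnot {R ∈ 𝓡 | s.sel R = ∅} ⟨{F}, F⟩ ∅ 𝒟) {σ : Subst Sg}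
    (hF : Drv Dv (F.subst σ)) (hk : (F.subst σ).wt w ≤ k) :
    ∃ R ∈ 𝒟, ∃ m, Inst Dv w R (F.subst σ) m := by
  have hstep : ∀ A ∈ Dv, w A ≤ k → (∃ p, A = .mevent p) ∨ ∃ R ∈ 𝓡, StepOf Dv w R A (w A) := by
    intro A hA hwA
    refine (hst A hA).imp_right fun ⟨R, hR, h⟩ => ?_
    exact hins _ (fun _ _ h hs => h.of_subsumes hs) R hR
      fun 𝒮 hS => hS.exists_stepOf hN h le_rfl hwA
  refine hD.exists_inst hN (fun G hG hme hwG => ?_) (n := (F.subst σ).wt w) ?_ hk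
    (fun R' hR' => absurd hR' (Set.notMem_empty R'))
  · obtain ⟨R, hR, hs, h⟩ := hfix.exists_inst hN hstep hRf hproj G hG hme hwG
    exact ⟨R, ⟨hR, hs⟩, h⟩
  · refine ⟨σ, rfl, fun F' hF' => ?_, ?_⟩
    · rw [Multiset.mem_singleton.1 hF']
      exact hF
    · simp [hypsWt]

/-- If the search for each fact of `Fnot` returns no clause, then no instance of a fact of `Fnot`
is derivable. -/
theorem not_drv_of_deriv_empty {𝓡₀ 𝓡 : Set (Clause Sg)} (hfix : IsFixpoint s Fnot 𝓡)
    (hins : ∀ Φ : Clause Sg → Prop, Upward Φ → ∀ R ∈ 𝓡₀,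
      (∀ 𝒮, Simplify Fnot R 𝒮 → ∃ R' ∈ 𝒮, Φ R') → ∃ R' ∈ 𝓡, Φ R')
    (hRf : ∀ f, Sg.IsData f → ∃ R ∈ 𝓡, R.Subsumes (clauseRf f (fun i => i)))
    (hst : Stepwise Dv w 𝓡₀) (hproj : Projects Dv w 𝓡)
    (hnot : ∀ F ∈ Fnot, Deriv s Fnot {R ∈ 𝓡 | s.sel R = ∅} ⟨{F}, F⟩ ∅ ∅) :
    ∀ F ∈ Fnot, ∀ σ : Subst Sg, ¬ Drv Dv (F.subst σ) := by
  intro F hF σ hd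
  induction hn : (F.subst σ).wt w using Nat.strong_induction_on generalizing F σ with
  | _ n ih =>
  -- Pruning is harmless strictly below n by induction. That is enough for a fact of weight n,
  -- because the start clause F ⇒ F is not simplified.
  have hN : Avoids Dv w Fnot n := fun F' hF' σ' hd' =>
    not_lt.1 fun hlt => ih _ hlt F' hF' σ' hd' rfl
  obtain ⟨R, hR, _⟩ :=
    (hnot F hF).exists_inst_of_stepwise hfix hins hRf hst hproj hN hd hn.le
  exact absurd hR (Set.notMem_empty R)

/-! ### Weighted derivations -/

/-- `A` is a component of a derivable fact, with a derivation of weight `n`. -/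
inductive WDer (𝓡 : Set (Clause Sg)) (Me : Set (Pat Sg)) : PFact Sg → ℕ → Prop
  | mevent (p : Pat Sg) (hp : p ∈ Me) : WDer 𝓡 Me (.mevent p) 0
  | step (R : Clause Sg) (hR : R ∈ 𝓡) (σ : Subst Sg) (c : PFact Sg → ℕ) (d : ℕ) (A : PFact Sg)
      (hc : ∀ F ∈ R.hyps, ∀ d' A', Leaf (F.subst σ) d' A' → WDer 𝓡 Me A' (c A'))
      (hA : Leaf (R.concl.subst σ) d A) : WDer 𝓡 Me A (1 + 2 * d + hypsWt c σ R.hyps)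

/-- The components of derivable facts. -/
def components (𝓡 : Set (Clause Sg)) (Me : Set (Pat Sg)) : Set (PFact Sg) :=
  {A | ∃ n, WDer 𝓡 Me A n}

/-- The minimal weight of a derivation. -/
noncomputable def minWt (𝓡 : Set (Clause Sg)) (Me : Set (Pat Sg)) (A : PFact Sg) : ℕ :=
  sInf {n | WDer 𝓡 Me A n}

variable {𝓡 : Set (Clause Sg)} {Me : Set (Pat Sg)}

theorem WDer.minWt {A : PFact Sg} (h : A ∈ components 𝓡 Me) : WDer 𝓡 Me A (minWt 𝓡 Me A) :=
  Nat.sInf_mem h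

/-- Each hypothesis component is given its minimal weight, which supplies the weight function
required by `WDer.step`. -/
theorem Der.drv {F : PFact Sg} (h : Der 𝓡 Me F) : Drv (components 𝓡 Me) F := by
  induction h with
  | mevent p hp =>
    intro d A hA
    rw [(Leaf.eq_of_not_isComposed (by rintro ⟨_, _, _, h⟩; cases h) hA).2]
    exact ⟨0, .mevent p hp⟩
  | clause R hR σ _ ih =>
    exact fun d A hA => ⟨_, .step R hR σ (PV.minWt 𝓡 Me) d A
      (fun F hF d' A' hA' => WDer.minWt (ih F hF d' A' hA')) hA⟩

/-- The last step of a cheapest derivation: replacing the recorded weights of the hypotheses by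
minimal ones can only lower its cost. -/
theorem stepwise_components : Stepwise (components 𝓡 Me) (minWt 𝓡 Me) 𝓡 := by
  intro A hA
  have h := WDer.minWt hA
  generalize hn : minWt 𝓡 Me A = n at h
  cases h with
  | mevent p hp => exact Or.inl ⟨p, rfl⟩
  | step R hR σ c d _ hc hL =>
    refine Or.inr ⟨R, hR, _, d, hypsWt c σ R.hyps, ⟨σ, rfl, fun F hF d' A' hA' =>
      ⟨_, hc F hF d' A' hA'⟩, ?_⟩, hL, le_rfl⟩
    exact Multiset.sum_map_le_sum_map _ _ fun F hF =>
      PFact.wt_mono _ fun d' A' hA' => Nat.sInf_le (hc F hF d' A' hA')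

/-! ### Origin of m-event facts -/

theorem mevent_mem_of_mem_components {p : Pat Sg} (h𝓡 : ∀ R ∈ 𝓡, ∀ q, R.concl ≠ .mevent q)
    (h : .mevent p ∈ components 𝓡 Me) : p ∈ Me := by
  obtain ⟨n, h⟩ := h
  cases h with
  | mevent _ hp => exact hp
  | step R hR σ c d _ hc hL =>
    have hR' := h𝓡 R hR
    rcases hRc : R.concl with q | _ | q | _ <;> rw [hRc] at hL
    · obtain ⟨_, h⟩ := hL.eq_attacker ⟨_, rfl⟩
      cases h
    · cases hL
    · exact absurd hRc (hR' q)
    · cases hL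

theorem IsTransl.concl_ne_mevent {n k : ℕ} (P : IProc Sg n k) {ρ : TEnv Sg n k}
    {H : Multiset (PFact Sg)} {𝒮 : Set (Clause Sg)} (hT : IsTransl P ρ H 𝒮) :
    ∀ R ∈ 𝒮, ∀ q, R.concl ≠ .mevent q := by
  induction P generalizing H 𝒮 with
  | out M N P ih =>
    obtain ⟨𝒮₁, h1, rfl⟩ := hT
    rintro R (hR | rfl) q
    · exact ih h1 R hR q
    · simp
  | inp M P ih =>
    obtain ⟨x, _, h1⟩ := hT
    exact ih h1
  | nil =>
    rw [show 𝒮 = ∅ from hT]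
    exact fun R hR => absurd hR (Set.notMem_empty R)
  | par P Q ihP ihQ =>
    obtain ⟨𝒮₁, 𝒮₂, h1, h2, rfl⟩ := hT
    rintro R (hR | hR)
    exacts [ihP h1 R hR, ihQ h2 R hR]
  | repl P ih =>
    obtain ⟨i, _, h1⟩ := hT
    exact ih h1
  | res ℓ P ih => exact ih hT
  | letd g Ms P Q ihP ihQ =>
    obtain ⟨𝒮₁, 𝒮₂, h1, h2, rfl⟩ := hT
    rintro R (hR | hR)
    · obtain ⟨r, hr, hR⟩ := Set.mem_iUnion₂.1 hR
      rcases h1 r hr with ⟨_, _, _, hP⟩ | ⟨_, h0⟩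
      · exact ihP hP R hR
      · rw [h0] at hR
        exact absurd hR (Set.notMem_empty R)
    · exact ihQ h2 R hR
  | cond M N P Q ihP ihQ =>
    obtain ⟨𝒮₁, 𝒮₂, h1, h2, rfl⟩ := hT
    rintro R (hR | hR)
    · rcases h1 with ⟨_, _, hP⟩ | ⟨_, h0⟩
      · exact ihP hP R hR
      · rw [h0] at hR
        exact absurd hR (Set.notMem_empty R)
    · exact ihQ h2 R hR
  | event M P ih =>
    obtain ⟨𝒮₁, h1, rfl⟩ := hT
    rintro R (hR | rfl) q
    · exact ih h1 R hR q
    · simp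

theorem AttackerClause.concl_ne_mevent {Init : Finset Name} {R : Clause Sg}
    (h : AttackerClause Init R) (q : Pat Sg) : R.concl ≠ .mevent q := by
  cases h <;> simp [clauseRf, clauseRg]

theorem IsClauseSet.concl_ne_mevent {P' : IProc Sg 0 0} {Init : Finset Name}
    {𝓡₀ : Set (Clause Sg)} (h : IsClauseSet P' Init 𝓡₀) :
    ∀ R ∈ 𝓡₀, ∀ q, R.concl ≠ .mevent q := by
  obtain ⟨𝒮, hT, rfl⟩ := h
  rintro R (hR | hR) q
  exacts [hT.concl_ne_mevent _ R hR q, AttackerClause.concl_ne_mevent hR q]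

/-! ### Assembling the completeness of the algorithm -/

theorem drv_b0 {Dv : Set (PFact Sg)} (hb : PFact.attacker (Pat.b0 Sg) ∈ Dv) :
    Drv Dv (.attacker (Pat.b0 Sg)) := fun d A hA => by
  rw [(Leaf.eq_of_not_isComposed Pat.b0_not_isComposed hA).2]
  exact hb

/-- If `F` is derivable, then it is the conclusion of an instance of a clause returned by the
algorithm, with derivable hypotheses. -/
theorem Solves.exists_inst {P' : IProc Sg 0 0} {Init : Finset Name} {F : PFact Sg}
    {𝒟 : Set (Clause Sg)} (h : Solves s Fnot P' Init F 𝒟) :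
    ∃ 𝓡₀, IsClauseSet P' Init 𝓡₀ ∧ ∀ (Me : Set (Pat Sg)) (σ : Subst Sg),
      Der 𝓡₀ Me (F.subst σ) → ∃ R ∈ 𝒟, ∃ θ : Subst Sg, R.concl.subst θ = F.subst σ ∧
        ∀ p, .mevent p ∈ R.hyps → p.subst θ ∈ Me := by
  obtain ⟨𝓡₀, 𝓡₁, hcl, hsat, hnot, hD⟩ := h
  refine ⟨𝓡₀, hcl, fun Me σ hder => ?_⟩
  obtain ⟨𝓡, hfix, rfl, hins⟩ := hsat.exists_isFixpoint
  have hatt : ∀ R, AttackerClause Init R → R ∈ 𝓡₀ := by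
    obtain ⟨𝒮, _, rfl⟩ := hcl
    exact fun R hR => Or.inr hR
  -- An instance attacker(x) would make the forbidden fact unselectable, and its search would not be
  -- empty. Hence the hypotheses of (Rf) are never forbidden.
  have hvar : ∀ F ∈ Fnot, ∀ τ : Subst Sg, ∀ x, F.subst τ ≠ .attacker (.var x) := by
    intro F hF τ x he
    have : Unselectable F := by
      rcases F with p | _ | _ | _
      · rcases p with y | _ | _
        · exact Or.inl ⟨y, rfl⟩
        all_goals injection he with h; cases h
      all_goals cases he
    exact Set.not_nonempty_empty (Deriv.nonempty_of_unselectable this (hnot F hF))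
  have hRf : ∀ f, Sg.IsData f → ∃ R ∈ 𝓡, R.Subsumes (clauseRf f (fun i => i)) := by
    intro f hf
    refine hins _ (upward_subsumes _) _ (hatt _ (.rf f hf.1)) fun 𝒮 hS => hS.exists_subsumes
      ⟨f, hf, fun i => i, Fin.val_injective, Or.inl rfl⟩ ?_ ?_
    · rintro ⟨F, hF, F', hF', τ, rfl⟩
      obtain ⟨i, hi⟩ := mem_clauseRf_hyps.1 hF
      exact hvar F' hF' τ _ hi
    · intro ht
      obtain ⟨i, hi⟩ := mem_clauseRf_hyps.1 ht
      simp [clauseRf] at hi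
  have hrn : ∀ A, A = PFact.attacker (Pat.b0 Sg) → ∀ (Dv : Set (PFact Sg)) (w : PFact Sg → ℕ) v,
      1 ≤ v → ∃ R ∈ 𝓡₀, StepOf Dv w R A v := by
    rintro A rfl Dv w v hv
    refine ⟨_, hatt _ .rn, _, 0, 0, ⟨⟨Pat.var, Sid.var⟩, rfl,
      fun F hF => absurd hF (Multiset.notMem_zero F), ?_⟩, ?_, by omega⟩
    · simp [hypsWt]
    · exact .self _ Pat.b0_not_isComposed
  -- Keeping the projections requires knowing that their hypothesis is not forbidden, while the
  -- general argument uses projections. The statement is first proved in a world whose only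
  -- component is b₀[x], of weight 1, where no projection is needed.
  have hnob0 := not_drv_of_deriv_empty (Dv := {.attacker (Pat.b0 Sg)}) (w := fun _ => 1) hfix hins
    hRf (fun A hA => Or.inr (hrn A hA _ _ _ le_rfl)) (Or.inr fun _ _ => le_rfl) hnot
  have hpr : ∀ f, Sg.IsData f → ∀ i, ∃ x : Fin (Sg.conArity f) → ℕ, Function.Injective x ∧
      ∃ R ∈ 𝓡, R.Subsumes (projClause f x i) := by
    intro f hf i
    obtain ⟨g, hg, hg1, x, hx, r, hr, hl, hrr⟩ := hf.2 i
    have hcl := hatt _ (.rg g hg r (by rw [hr]; exact Finset.mem_singleton_self r))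
    rw [clauseRg_eq_projClause hg1 r hl hrr] at hcl
    refine ⟨x, hx, hins _ (upward_subsumes _) _ hcl fun 𝒮 hS => hS.exists_subsumes
      ⟨f, hf, x, hx, Or.inr ⟨i, rfl⟩⟩ ?_ ?_⟩
    · rintro ⟨F, hF, F', hF', τ, rfl⟩
      -- With b₀[x] for every variable, a forbidden hypothesis attacker(f(x₁, …, xₙ)) becomes a fact
      -- whose only possible component is b₀[x], derivable in that small world.
      refine hnob0 F' hF' (Subst.comp ⟨fun _ => Pat.b0 Sg, Sid.var⟩ τ) ?_
      rw [PFact.subst_comp, Multiset.mem_singleton.1 hF]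
      intro d A hA
      obtain ⟨j, d', _, h⟩ := Leaf.of_app hf hA
      exact drv_b0 (Set.mem_singleton _) d' A h
    · intro ht
      have := Multiset.mem_singleton.1 ht
      simp [projClause] at this
  have hb : WDer 𝓡₀ Me (.attacker (Pat.b0 Sg)) 1 := by
    have := WDer.step (Me := Me) _ (hatt _ .rn) ⟨Pat.var, Sid.var⟩ (fun _ => 0) 0
      (.attacker (Pat.b0 Sg)) (fun F hF => absurd hF (Multiset.notMem_zero F))
      (.self _ Pat.b0_not_isComposed)
    simpa [hypsWt] using this
  have hproj : Projects (components 𝓡₀ Me) (minWt 𝓡₀ Me) 𝓡 := Or.inl ⟨⟨1, hb⟩, Nat.sInf_le hb, hpr⟩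
  -- The same argument, now with all derivable components: no forbidden instance is derivable at any
  -- weight, so pruning is harmless in the search for F.
  have hno := not_drv_of_deriv_empty hfix hins hRf stepwise_components hproj hnot
  obtain ⟨R, hR, m, θ, h1, h2, _⟩ := Deriv.exists_inst_of_stepwise (𝓡₀ := 𝓡₀) hfix hins hRf
    stepwise_components hproj (fun F hF σ hd => absurd hd (hno F hF σ)) hD hder.drv le_rfl
  refine ⟨R, hR, θ, h1, fun p hp => mevent_mem_of_mem_components hcl.concl_ne_mevent ?_⟩
  exact h2 _ hp 0 _ (.self _ (by rintro ⟨_, _, _, h⟩; cases h))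

end

end PV

/-! ### The correspondence theorem -/

theorem mainTheorem11 (Sg : PV.Signature.{u, v}) (Init : Finset PV.Name)
    (s : PV.SelectionFunction Sg) (Fnot : Set (PV.PFact Sg)) (P₀ : PV.Proc Sg 0)
    (F : PV.PFact Sg) (m : ℕ) (l : Fin m → ℕ) (Fj : Fin m → PV.PFact Sg)
    (p : (j : Fin m) → Fin (l j) → PV.Pat Sg) (𝒟 : Set (PV.Clause Sg))
    (hsolve : PV.Solves s Fnot (PV.instr P₀) Init F 𝒟)
    (hshape : ∀ R ∈ 𝒟, ∃ (j : Fin m) (σ' : PV.Subst Sg),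
      R.concl = (Fj j).subst σ' ∧ ∀ k : Fin (l j), PV.PFact.mevent ((p j k).subst σ') ∈ R.hyps) :
    PV.SatisfiesCorrespondence Init (PV.instr P₀) F l Fj p := by
  intro Q hQ S₀ E₀ hdom hE₀ T hT σ hsat
  obtain ⟨𝓡₀, hcl, hcomplete⟩ := hsolve.exists_inst
  obtain ⟨R, hR, θ, hc, hme⟩ := hcomplete _ σ (hsat.der hcl hQ hdom hE₀ hT)
  obtain ⟨j, σ', hRc, hRh⟩ := hshape R hR
  -- σ' matches the correspondence with the returned clause, and θ matches that clause with the
  -- satisfied fact.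
  refine ⟨θ.comp σ', j, ?_, fun k => ?_⟩
  · rw [PV.PFact.subst_comp, ← hRc, hc]
  · rw [PV.Pat.subst_comp]
    exact hme _ (hRh k)
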